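/- Let $S=\mathbf{C}[z_0,z_1,z_2]$, let $S_d$ be the space of forms of degree $d$ (so $S_d=0$ for $d<0$), and let $J\subset S$ be the homogeneous saturated ideal of a (nonempty) zero-dimensional subscheme of $\mathbf{P}^2$. Let \[ 0\to \bigoplus_{i=1}^t S(-b_i)\to\bigoplus_{i=1}^{t+1}S(-a_i)\to S\to S/J\to 0 \] be a minimal graded free resolution of $S/J$. For a zero-dimensional scheme $Z\subset\mathbf{P}^2$ and $d\in\mathbf{Z}$, the defect of the linear system of degree $d$ polynomials vanishing along $Z$ is the dimension of the cokernel of the evaluation map $S_d\to H^0(Z,\mathcal{O}_Z(d))$. For $g_0,g_1,g_2\in S_m$ let $\varphi=(g_0:g_1:g_2)$ and let $\varphi^*(J)\subset S$ be the ideal generated by all $F(g_0,g_1,g_2)$ with $F\in J$. "For general $g_0,g_1,g_2\in S_m$" means: for all $(g_0,g_1,g_2)$ in some nonempty Zariski open subset of $(S_m)^3$ (which may depend on $m$); for general $g_0,g_1,g_2$ the map $\varphi:\mathbf{P}^2\to\mathbf{P}^2$ is a morphism and $Z(\varphi^*(J))$ is zero-dimensional. Suppose that there are an integer $n$ and a linear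 function $g(m)=\alpha m+\beta$ ($\alpha,\beta\in\mathbf{R}$) such that for all positive integers $m$ and for general $g_0,g_1,g_2\in S_m$ the defect $\delta_m$ of the linear system of degree $mn-3$ polynomials vanishing along $Z(\varphi^*(J))$ is at most $g(m)$. Then $b_i\le n$ for $i=1,\dots,t$, $a_i<n$ for $i=1,\dots,t+1$, and for all positive integers $m$ and for general $g_0,g_1,g_2\in S_m$ one has $\delta_m=\#\{i\mid b_i=n\}$. -/

import Mathlib

open MvPolynomial

noncomputable section

namespace PlaneScheme

/-- The homogeneous coordinate ring `S = ℂ[z₀, z₁, z₂]` of the projective plane. -/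
abbrev S : Type := MvPolynomial (Fin 3) ℂ

/-- The projective plane over `ℂ` (its closed points). -/
abbrev P2 : Type := Projectivization ℂ (Fin 3 → ℂ)

/-- The space `S_d` of forms of degree `d`, for an integer `d`; it is zero for `d < 0`. -/
abbrev forms (d : ℤ) : Submodule ℂ S :=
  weightedHomogeneousSubmodule ℂ (fun _ : Fin 3 => (1 : ℤ)) d

/-- The set of closed points of the scheme `Z(K)` of a homogeneous ideal `K`. -/
def points (K : Ideal S) : Set P2 :=
  {p | ∀ f ∈ K, eval p.rep f = 0}

/-- `J` is the ideal of a zero-dimensional subscheme of the plane: it is homogeneous, saturated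
with respect to the irrelevant ideal, and its scheme has at least one and only finitely many
closed points. -/
structure IsIdealOfZeroDimScheme (J : Ideal S) : Prop where
  homogeneous : ∀ f ∈ J, ∀ d : ℕ, homogeneousComponent d f ∈ J
  saturated : ∀ f : S, (∀ i : Fin 3, X i * f ∈ J) → f ∈ J
  nonempty : (points J).Nonempty
  finite : (points J).Finite

/-- The row `f` of `t + 1` forms and the matrix `M` are the maps of a minimal graded free resolution
`0 → ⨁ⱼ S(-b j) → ⨁ᵢ S(-a i) → S → S/J → 0`. -/
structure IsMinimalResolution (J : Ideal S) {t : ℕ} (a : Fin (t + 1) → ℤ) (b : Fin t → ℤ)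
    (f : Fin (t + 1) → S) (M : Matrix (Fin (t + 1)) (Fin t) S) : Prop where
  /-- The maps preserve degrees. -/
  degree_f : ∀ i, f i ∈ forms (a i)
  degree_M : ∀ i j, M i j ∈ forms (b j - a i)
  /-- Exactness at the three places. -/
  span_f : Ideal.span (Set.range f) = J
  exact : Function.Exact M.mulVecLin (Fintype.linearCombination S f)
  injective : Function.Injective M.mulVecLin
  /-- Minimality: all entries lie in the irrelevant ideal `(z₀, z₁, z₂)`. -/
  minimal_f : ∀ i, constantCoeff (f i) = 0
  minimal_M : ∀ i j, constantCoeff (M i j) = 0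

/-- The forms (of any degree) that vanish at no point of `Z(K)`. -/
def nonvanishing (K : Ideal S) : Submonoid S where
  carrier := {h | (∃ e : ℤ, h ∈ forms e) ∧ ∀ p ∈ points K, eval p.rep h ≠ 0}
  one_mem' := ⟨⟨0, isWeightedHomogeneous_one ℂ _⟩, fun p _ => by simp⟩
  mul_mem' := by
    rintro x y ⟨⟨d, hx⟩, hx'⟩ ⟨⟨e, hy⟩, hy'⟩
    refine ⟨⟨d + e, IsWeightedHomogeneous.mul hx hy⟩, fun p hp => ?_⟩
    rw [map_mul]
    exact mul_ne_zero (hx' p hp) (hy' p hp)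

/-- The localization of `S/K` at the forms that vanish at no point of `Z(K)`. -/
abbrev LocRing (K : Ideal S) : Type :=
  Localization ((nonvanishing K).map (Ideal.Quotient.mk K))

/-- The canonical map `S → S/K → LocRing K`. -/
def toLoc (K : Ideal S) : S →ₐ[ℂ] LocRing K :=
  (IsScalarTower.toAlgHom ℂ (S ⧸ K) (LocRing K)).comp (Ideal.Quotient.mkₐ ℂ K)

/-- The space `H⁰(Z, 𝒪_Z(d))` of global sections for a zero-dimensional scheme `Z = Z(K)`:
fractions `f/h` of forms modulo `K` with `deg f - deg h = d`, where `h` vanishes at no point of `Z`.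
(As `Z` is finite, it lies in the affine open set `h ≠ 0` of a form `h`, and these
fractions are all the sections.) -/
def sections (K : Ideal S) (d : ℤ) : Submodule ℂ (LocRing K) where
  carrier := {x | ∃ e : ℤ, ∃ h ∈ nonvanishing K, ∃ f ∈ forms (d + e),
    h ∈ forms e ∧ toLoc K h * x = toLoc K f}
  zero_mem' := ⟨0, 1, one_mem _, 0, zero_mem _, isWeightedHomogeneous_one ℂ _, by simp⟩
  add_mem' := by
    rintro x y ⟨e, h, hh, f, hf, hd, hx⟩ ⟨e', h', hh', f', hf', hd', hy⟩
    refine ⟨e + e', h * h', mul_mem hh hh', f * h' + h * f', ?_,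
      IsWeightedHomogeneous.mul hd hd', ?_⟩
    · refine add_mem ?_ ?_
      · have := IsWeightedHomogeneous.mul hf hd'
        rwa [show d + e + e' = d + (e + e') by ring] at this
      · have := IsWeightedHomogeneous.mul hd hf'
        rwa [show e + (d + e') = d + (e + e') by ring] at this
    · simp only [map_mul, map_add, ← hx, ← hy]
      ring
  smul_mem' := by
    rintro c x ⟨e, h, hh, f, hf, hd, hx⟩
    refine ⟨e, h, hh, c • f, Submodule.smul_mem _ c hf, hd, ?_⟩
    rw [map_smul, ← hx, mul_smul_comm]

/-- The defect of the linear system of forms of degree `d` vanishing along `Z = Z(K)`: the dimension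
of the cokernel of the evaluation map `S_d → H⁰(Z, 𝒪_Z(d))`. -/
def defect (K : Ideal S) (d : ℤ) : ℕ :=
  Module.finrank ℂ
    (sections K d ⧸ ((forms d).map (toLoc K).toLinearMap).submoduleOf (sections K d))

/-- The ideal of the pullback of `Z(J)` along `(z₀ : z₁ : z₂) ↦ (g₀ : g₁ : g₂)`. -/
def pullback (g : Fin 3 → S) (J : Ideal S) : Ideal S :=
  J.map (aeval g : S →ₐ[ℂ] S)

/-- The property `Q` holds for a general triple of forms of degree `m`: it holds on a nonempty
Zariski open subset of `(S_m)³`, here the set where some polynomial `P` in the coefficients of the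
three forms, not identically zero on `(S_m)³`, is nonzero. -/
def ForGeneral (m : ℕ) (Q : (Fin 3 → S) → Prop) : Prop :=
  ∃ P : MvPolynomial (Fin 3 × (Fin 3 →₀ ℕ)) ℂ,
    (∃ g : Fin 3 → S, (∀ i, (g i).IsHomogeneous m) ∧
      eval (fun q => coeff q.2 (g q.1)) P ≠ 0) ∧
    ∀ g : Fin 3 → S, (∀ i, (g i).IsHomogeneous m) →
      eval (fun q => coeff q.2 (g q.1)) P ≠ 0 → Q g

end PlaneScheme

end

noncomputable section

namespace PlaneScheme

/-! Write h for the Hilbert function `hilb J` of S/J and c for its eventual value, the degree of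
Z(J). For general g the ring S is free over ℂ[g₀, g₁, g₂] with basis the monomials z^e, all eᵢ < m
(`forGeneral_assemble_bijective`). Hence S/φ*(J) splits into copies of S/J, with degrees multiplied
by m and shifted by |e|. A linear form missing Z(J) is a nonzerodivisor modulo J, and its pullback L
is one modulo φ*(J). Dividing by a high power of L computes H⁰, so the defect in degree d is the sum
of c - h((d - |e|)/m) over those e with m ∣ d - |e| (`defect_pullback`).

For d = mn - 3 the arguments of h that can occur are n - 1, n - 2 and n - 3, according to whether
|e| is m - 3, 2m - 3 or 3m - 3. The exponents with |e| = 2m - 3 grow quadratically in number, so a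
linear bound forces h(n - 2) = c, and h = c from there on because h is nondecreasing
(`hilb_eq_of_defect_bound`). Only e = (m-1, m-1, m-1) has |e| = 3m - 3, so the defect is then c -
h(n - 3) for every m (`defect_pullback_eq`).

The third difference of h at k ≠ 0 equals #{b_j = k} - #{a_i = k} (`third_diff_hilb`). It vanishes
for k > n and is c - h(n - 3) at k = n. By minimality each a_i lies below some b_j, so no b_j
exceeds n, all a_i are below n, and c - h(n - 3) = #{b_j = n} (`degree_bounds`). -/

/-! ### Graded pieces of `S` -/

/-- The forms of degree `c` when all three variables have weight `w`. -/
abbrev wforms (w c : ℤ) : Submodule ℂ S :=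
  weightedHomogeneousSubmodule ℂ (fun _ : Fin 3 => w) c

/-- The component of degree `c` when all three variables have weight `w`. -/
abbrev comp (w c : ℤ) : S →ₗ[ℂ] S :=
  weightedHomogeneousComponent (fun _ : Fin 3 => w) c

lemma weight_const (w : ℤ) (α : Fin 3 →₀ ℕ) :
    Finsupp.weight (fun _ : Fin 3 => w) α = (α.degree : ℤ) * w := by
  rw [Finsupp.weight_apply, Finsupp.sum, Finsupp.degree_apply, Nat.cast_sum, Finset.sum_mul]
  simp

lemma mem_wforms {w c : ℤ} {F : S} :
    F ∈ wforms w c ↔ ∀ α, coeff α F ≠ 0 → (α.degree : ℤ) * w = c := by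
  simp [mem_weightedHomogeneousSubmodule, IsWeightedHomogeneous, weight_const]

lemma mem_forms {d : ℤ} {F : S} : F ∈ forms d ↔ ∀ α, coeff α F ≠ 0 → (α.degree : ℤ) = d := by
  simpa using mem_wforms (w := 1)

lemma coeff_comp (w c : ℤ) (F : S) (α : Fin 3 →₀ ℕ) :
    coeff α (comp w c F) = if (α.degree : ℤ) * w = c then coeff α F else 0 := by
  rw [coeff_weightedHomogeneousComponent, weight_const]

lemma comp_mem (w c : ℤ) (F : S) : comp w c F ∈ wforms w c :=
  weightedHomogeneousComponent_mem _ _ _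

lemma comp_of_mem {w c : ℤ} {F : S} (h : F ∈ wforms w c) : comp w c F = F :=
  weightedHomogeneousComponent_eq_self h

lemma comp_one_natCast (d : ℕ) (F : S) : comp 1 d F = homogeneousComponent d F := by
  ext α
  rw [coeff_comp, coeff_homogeneousComponent]
  simp

lemma comp_one_of_neg {d : ℤ} (hd : d < 0) (F : S) : comp 1 d F = 0 := by
  ext α
  rw [coeff_comp, coeff_zero, if_neg]
  have := Int.natCast_nonneg α.degree
  lia

lemma comp_mul {w : ℤ} (hw : w ≠ 0) (q : ℤ) (F : S) : comp w (w * q) F = comp 1 q F := by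
  ext α
  simp only [coeff_comp, mul_one, mul_comm w q, mul_left_inj' hw]

lemma comp_of_not_dvd {w c : ℤ} (h : ¬ w ∣ c) (F : S) : comp w c F = 0 := by
  ext α
  rw [coeff_comp, coeff_zero, if_neg]
  rintro rfl
  exact h (Dvd.intro_left _ rfl)

lemma wforms_mul {w : ℤ} (hw : w ≠ 0) (q : ℤ) : wforms w (w * q) = forms q := by
  ext F
  rw [mem_wforms, mem_forms, mul_comm w q]
  simp [hw]

lemma wforms_of_not_dvd {w c : ℤ} (h : ¬ w ∣ c) : wforms w c = ⊥ := by
  refine (Submodule.eq_bot_iff _).2 fun F hF => ?_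
  rw [← comp_of_mem hF, comp_of_not_dvd h]

lemma forms_of_neg {d : ℤ} (hd : d < 0) : forms d = ⊥ := by
  refine (Submodule.eq_bot_iff _).2 fun F hF => ?_
  rw [← comp_of_mem hF, comp_one_of_neg hd]

lemma mem_forms_natCast {d : ℕ} {F : S} : F ∈ forms d ↔ F.IsHomogeneous d := by
  rw [mem_forms]
  refine forall_congr' fun α => imp_congr_right fun _ => ?_
  rw [Nat.cast_inj, Finsupp.degree_eq_weight_one]
  rfl

lemma X_mem_forms (i : Fin 3) : (X i : S) ∈ forms 1 :=
  isWeightedHomogeneous_X ℂ _ i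

lemma monomial_mem_forms (α : Fin 3 →₀ ℕ) (c : ℂ) : (monomial α c : S) ∈ forms α.degree :=
  isWeightedHomogeneous_monomial _ _ _ (by rw [weight_const, mul_one])

lemma mul_mem_forms {d e : ℤ} {F G : S} (hF : F ∈ forms d) (hG : G ∈ forms e) :
    F * G ∈ forms (d + e) :=
  IsWeightedHomogeneous.mul hF hG

lemma pow_mem_forms {d : ℤ} {F : S} (hF : F ∈ forms d) (k : ℕ) : F ^ k ∈ forms (k * d) := by
  have := IsWeightedHomogeneous.pow hF k
  rwa [nsmul_eq_mul] at this

/-- Multiplication by a form shifts the graded components. -/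
lemma comp_form_mul {e : ℤ} {G : S} (hG : G ∈ forms e) (d : ℤ) (F : S) :
    comp 1 (e + d) (G * F) = G * comp 1 d F := by
  let _ := weightedGradedAlgebra ℂ (fun _ : Fin 3 => (1 : ℤ))
  have h := DirectSum.coe_decompose_mul_add_of_left_mem
    (weightedHomogeneousSubmodule ℂ (fun _ : Fin 3 => (1 : ℤ))) (b := F) (j := d) hG
  refine (weightedDecomposition.decompose'_apply ℂ _ (G * F) (e + d)).symm.trans (h.trans ?_)
  exact congrArg (G * ·) (weightedDecomposition.decompose'_apply ℂ _ F d)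

lemma eq_zero_of_comp {w : ℤ} {F : S} (h : ∀ d, comp w d F = 0) : F = 0 := by
  rw [← finsum_weightedHomogeneousComponent (fun _ : Fin 3 => w) F]
  simp [h]

lemma sum_comp (w : ℤ) (F : S) : ∃ s : Finset ℤ, F = ∑ d ∈ s, comp w d F := by
  have h := weightedHomogeneousComponent_finsupp (w := fun _ : Fin 3 => w) F
  exact ⟨h.toFinset, by
    conv_lhs => rw [← finsum_weightedHomogeneousComponent (fun _ : Fin 3 => w) F]
    exact finsum_eq_sum _ h⟩

/-- A form of degree `d` is determined by its coefficients at the exponents of degree `d`. -/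
def coeffEquiv (d : ℕ) :
    forms d ≃ₗ[ℂ] ((Finset.univ : Finset (Fin 3)).finsuppAntidiag d → ℂ) := by
  refine LinearEquiv.ofBijective
    (LinearMap.pi fun α => (lcoeff ℂ α.1).comp (forms d).subtype) ⟨?_, ?_⟩
  · rw [← LinearMap.ker_eq_bot, LinearMap.ker_eq_bot']
    intro F hF
    ext α
    by_contra hα
    have h1 := mem_forms.1 F.2 α hα
    have h2 := congrFun hF ⟨α, by
      rw [Finset.mem_finsuppAntidiag]
      exact ⟨by rw [← Finsupp.degree_eq_sum]; exact_mod_cast h1, Finset.subset_univ _⟩⟩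
    exact hα h2
  · intro c
    refine ⟨⟨∑ α : (Finset.univ : Finset (Fin 3)).finsuppAntidiag d, monomial α.1 (c α),
      sum_mem fun α _ => ?_⟩, ?_⟩
    · have h := monomial_mem_forms α.1 (c α)
      have h2 := (Finset.mem_finsuppAntidiag.1 α.2).1
      rwa [Finsupp.degree_eq_sum, h2] at h
    · ext β
      simp only [LinearMap.pi_apply, LinearMap.comp_apply, Submodule.subtype_apply, lcoeff_apply,
        coeff_sum, coeff_monomial]
      rw [Finset.sum_eq_single β]
      · simp
      · intro α _ h
        rw [if_neg fun h' => h (Subtype.ext h')]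
      · simp

instance (d : ℤ) : FiniteDimensional ℂ (forms d) := by
  rcases lt_or_ge d 0 with h | h
  · rw [forms_of_neg h]
    infer_instance
  · lift d to ℕ using h
    exact (coeffEquiv d).symm.finiteDimensional

lemma finrank_forms (d : ℕ) : Module.finrank ℂ (forms d) = (d + 2).choose 2 := by
  rw [(coeffEquiv d).finrank_eq, Module.finrank_fintype_fun_eq_card, Fintype.card_coe,
    Finset.card_finsuppAntidiag_nat_eq_choose, Finset.card_univ, Fintype.card_fin,
    show 3 + d - 1 = d + 2 by lia, ← Nat.choose_symm (by lia)]
  simp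

/-- The polynomial also vanishes at -2 and -1, so for k > 0 one formula serves all of k, k - 1, k -
2, k - 3. -/
lemma two_mul_finrank_forms {d : ℤ} (hd : -2 ≤ d) :
    2 * (Module.finrank ℂ (forms d) : ℤ) = (d + 2) * (d + 1) := by
  rcases lt_or_ge d 0 with h | h
  · rw [forms_of_neg h, finrank_bot]
    obtain rfl | rfl : d = -2 ∨ d = -1 := by lia
    all_goals norm_num
  · lift d to ℕ using h
    rw [finrank_forms]
    rw [Nat.choose_two_right]
    have h2 : 2 ∣ (d + 2) * (d + 2 - 1) := (Nat.even_mul_pred_self (d + 2)).two_dvd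
    obtain ⟨k, hk⟩ := h2
    rw [hk, Nat.mul_div_cancel_left _ two_pos]
    have : ((d + 2) * (d + 1) : ℤ) = 2 * k := by exact_mod_cast hk
    rw [this]

/-- The third difference of the Hilbert function of `S` is concentrated in degree zero. -/
lemma third_diff_finrank_forms (k : ℤ) :
    (Module.finrank ℂ (forms k) : ℤ) - 3 * Module.finrank ℂ (forms (k - 1))
      + 3 * Module.finrank ℂ (forms (k - 2)) - Module.finrank ℂ (forms (k - 3))
      = if k = 0 then 1 else 0 := by
  have key : ∀ d : ℤ, d < 0 → (Module.finrank ℂ (forms d) : ℤ) = 0 := fun d hd => by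
    rw [forms_of_neg hd, finrank_bot]; rfl
  rcases lt_trichotomy k 0 with h | rfl | h
  · rw [key _ h, key _ (by lia), key _ (by lia), key _ (by lia), if_neg h.ne]
    norm_num
  · rw [key (0 - 1) (by lia), key (0 - 2) (by lia), key (0 - 3) (by lia), if_pos rfl]
    have := two_mul_finrank_forms (d := 0) (by lia)
    lia
  · rw [if_neg h.ne']
    have h0 := two_mul_finrank_forms (d := k) (by lia)
    have h1 := two_mul_finrank_forms (d := k - 1) (by lia)
    have h2 := two_mul_finrank_forms (d := k - 2) (by lia)
    have h3 := two_mul_finrank_forms (d := k - 3) (by lia)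
    linarith

/-! ### Homogeneous ideals -/

/-- The ideal `K` is homogeneous for the standard grading of `S`. -/
def IsHomog (K : Ideal S) : Prop := ∀ F ∈ K, ∀ d : ℤ, comp 1 d F ∈ K

lemma IsIdealOfZeroDimScheme.isHomog {J : Ideal S} (hJ : IsIdealOfZeroDimScheme J) :
    IsHomog J := by
  intro F hF d
  rcases lt_or_ge d 0 with h | h
  · rw [comp_one_of_neg h]
    exact zero_mem _
  · lift d to ℕ using h
    rw [comp_one_natCast]
    exact hJ.homogeneous F hF d

lemma eval_smul_of_mem_forms {d : ℤ} {F : S} (hF : F ∈ forms d) (c : ℂˣ) (v : Fin 3 → ℂ) :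
    eval ((c : ℂ) • v) F = (c : ℂ) ^ d * eval v F := by
  rw [eval_eq, eval_eq, Finset.mul_sum]
  refine Finset.sum_congr rfl fun α hα => ?_
  have h := mem_forms.1 hF α (mem_support_iff.1 hα)
  rw [← h, zpow_natCast, Finsupp.degree_apply]
  simp only [Pi.smul_apply, smul_eq_mul, mul_pow, Finset.prod_mul_distrib, Finset.prod_pow_eq_pow_sum]
  ring

/-- `points` tests only the chosen representative of a point. Homogeneity makes the choice
irrelevant, because scaling multiplies each graded component by a power. -/
lemma IsHomog.eval_smul_eq_zero {K : Ideal S} (hK : IsHomog K) {v : Fin 3 → ℂ}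
    (hv : ∀ F ∈ K, eval v F = 0) (c : ℂˣ) {F : S} (hF : F ∈ K) : eval ((c : ℂ) • v) F = 0 := by
  obtain ⟨s, hs⟩ := sum_comp 1 F
  rw [hs, map_sum]
  refine Finset.sum_eq_zero fun d _ => ?_
  rw [eval_smul_of_mem_forms (comp_mem 1 d F), hv _ (hK F hF d), mul_zero]

lemma IsHomog.mk_mem_points {K : Ideal S} (hK : IsHomog K) {v : Fin 3 → ℂ} (hv0 : v ≠ 0)
    (hv : ∀ F ∈ K, eval v F = 0) : Projectivization.mk ℂ v hv0 ∈ points K := by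
  intro F hF
  obtain ⟨c, hc⟩ := Projectivization.exists_smul_eq_mk_rep ℂ v hv0
  rw [← hc]
  exact hK.eval_smul_eq_zero hv c hF

lemma IsHomog.eval_ne_zero {K : Ideal S} (hK : IsHomog K) {v : Fin 3 → ℂ} (hv0 : v ≠ 0)
    (hv : ∀ F ∈ K, eval v F = 0) {H : S} (hH : H ∈ nonvanishing K) : eval v H ≠ 0 := by
  obtain ⟨⟨e, he⟩, hne⟩ := hH
  obtain ⟨c, hc⟩ := Projectivization.exists_smul_eq_mk_rep ℂ v hv0
  have := hne _ (hK.mk_mem_points hv0 hv)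
  rw [← hc, Units.smul_def, eval_smul_of_mem_forms he] at this
  exact right_ne_zero_of_mul this

/-- Projective Nullstellensatz for an ideal without zeros outside of the origin. -/
lemma exists_idealOfVars_pow_le {K : Ideal S}
    (h : ∀ v : Fin 3 → ℂ, v ≠ 0 → ∃ F ∈ K, eval v F ≠ 0) :
    ∃ N : ℕ, idealOfVars (Fin 3) ℂ ^ N ≤ K := by
  refine Ideal.exists_pow_le_of_le_radical_of_fg ?_ (idealOfVars_fg (Fin 3) ℂ)
  rw [← vanishingIdeal_zeroLocus_eq_radical (K := ℂ), idealOfVars, Ideal.span_le]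
  rintro _ ⟨i, rfl⟩
  rw [SetLike.mem_coe, mem_vanishingIdeal_iff]
  intro v hv
  have : v = 0 := by
    by_contra hv0
    obtain ⟨F, hF, hne⟩ := h v hv0
    exact hne (by simpa [aeval_eq_eval] using mem_zeroLocus_iff.1 hv F hF)
  simp [this]

lemma mem_idealOfVars_pow {d : ℤ} {F : S} (hF : F ∈ forms d) {N : ℕ} (h : (N : ℤ) ≤ d) :
    F ∈ idealOfVars (Fin 3) ℂ ^ N := by
  rw [mem_pow_idealOfVars_iff]
  intro α hα
  have := mem_forms.1 hF α (mem_support_iff.1 hα)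
  lia

/-- A common zero of K and H off the origin would be a point of Z(K) at which H vanishes, so the
Nullstellensatz applies. -/
lemma IsHomog.exists_idealOfVars_pow_le {K : Ideal S} (hK : IsHomog K) {H : S}
    (hH : H ∈ nonvanishing K) : ∃ N : ℕ, idealOfVars (Fin 3) ℂ ^ N ≤ K ⊔ Ideal.span {H} := by
  refine PlaneScheme.exists_idealOfVars_pow_le fun v hv0 => ?_
  by_contra! hcon
  refine hK.eval_ne_zero hv0 (fun F hF => hcon F (Ideal.mem_sup_left hF)) hH
    (hcon H (Ideal.mem_sup_right (Ideal.mem_span_singleton_self H)))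

/-- In large degrees every form is, modulo `K`, a multiple of a given form that vanishes at no point
of `Z(K)`. -/
lemma IsHomog.exists_forms_sub_mul_mem {K : Ideal S} (hK : IsHomog K) {H : S} {e : ℤ}
    (hH : H ∈ nonvanishing K) (he : H ∈ forms e) :
    ∃ N : ℕ, ∀ d : ℤ, (N : ℤ) ≤ e + d → ∀ F ∈ forms (e + d),
      ∃ G ∈ forms d, F - H * G ∈ K := by
  obtain ⟨N, hN⟩ := hK.exists_idealOfVars_pow_le hH
  refine ⟨N, fun d hd F hF => ?_⟩
  obtain ⟨k, hk, y, hy, hsum⟩ := Submodule.mem_sup.1 (hN (mem_idealOfVars_pow hF hd))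
  obtain ⟨G, rfl⟩ := Ideal.mem_span_singleton'.1 hy
  refine ⟨comp 1 d G, comp_mem 1 d G, ?_⟩
  have h1 : comp 1 (e + d) F = F := comp_of_mem hF
  have h2 := comp_form_mul he d G
  rw [← h1, ← h2, ← map_sub, ← hsum, mul_comm H G, add_sub_cancel_right]
  exact hK k hk _

/-- A form that vanishes at no point of `Z(J)` is a nonzerodivisor modulo the saturated ideal `J`. -/
lemma IsIdealOfZeroDimScheme.mem_of_mul_mem {J : Ideal S} (hJ : IsIdealOfZeroDimScheme J) {H : S}
    (hH : H ∈ nonvanishing J) {F : S} (h : H * F ∈ J) : F ∈ J := by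
  obtain ⟨N, hN⟩ := hJ.isHomog.exists_idealOfVars_pow_le hH
  have key : ∀ G ∈ idealOfVars (Fin 3) ℂ ^ N, G * F ∈ J := by
    intro G hG
    obtain ⟨j, hj, y, hy, rfl⟩ := Submodule.mem_sup.1 (hN hG)
    obtain ⟨G', rfl⟩ := Ideal.mem_span_singleton'.1 hy
    rw [add_mul, mul_assoc]
    exact add_mem (J.mul_mem_right _ hj) (J.mul_mem_left _ h)
  -- Saturation removes one power of the irrelevant ideal at a time.
  have down : ∀ k : ℕ, (∀ G ∈ idealOfVars (Fin 3) ℂ ^ k, G * F ∈ J) → F ∈ J := by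
    intro k
    induction k with
    | zero => intro hk; simpa using hk 1 (by simp)
    | succ k ih =>
      refine fun hk => ih fun G hG => hJ.saturated _ fun i => ?_
      rw [← mul_assoc]
      refine hk _ ?_
      rw [pow_succ']
      exact Ideal.mul_mem_mul (Ideal.subset_span ⟨i, rfl⟩) hG
  exact down N key

/-- Some linear form vanishes at no point of a given finite set. -/
lemma IsIdealOfZeroDimScheme.exists_linear_nonvanishing {J : Ideal S}
    (hJ : IsIdealOfZeroDimScheme J) : ∃ ℓ ∈ forms 1, ℓ ∈ nonvanishing J := by
  have := hJ.finite.to_subtype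
  obtain ⟨φ, hφ⟩ := Module.exists_dual_forall_apply_ne_zero (K := ℂ)
    (fun p : points J => p.1.rep) fun p => p.1.rep_nonzero
  have hmem : (∑ i, φ (fun j => if i = j then 1 else 0) • X i : S) ∈ forms 1 :=
    sum_mem fun i _ => Submodule.smul_mem _ _ (X_mem_forms i)
  refine ⟨∑ i, φ (fun j => if i = j then 1 else 0) • X i, hmem, ⟨1, hmem⟩, fun p hp => ?_⟩
  have h := hφ ⟨p, hp⟩
  rw [LinearMap.pi_apply_eq_sum_univ φ] at h
  simpa only [map_sum, smul_eval, eval_X, smul_eq_mul, mul_comm] using h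

/-! ### Hilbert functions -/

lemma comp_form_mul_sub {e : ℤ} {G : S} (hG : G ∈ forms e) (d : ℤ) (F : S) :
    comp 1 d (G * F) = G * comp 1 (d - e) F := by
  rw [← comp_form_mul hG, add_sub_cancel]

/-- The dimension of the space of forms of degree `d` in the ideal `K`. -/
def idealDim (K : Ideal S) (d : ℤ) : ℕ :=
  Module.finrank ℂ (K.restrictScalars ℂ ⊓ forms d : Submodule ℂ S)

/-- The Hilbert function of `S/K`. -/
def hilb (K : Ideal S) (d : ℤ) : ℤ :=
  Module.finrank ℂ (forms d) - idealDim K d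

lemma finrank_map_add_finrank_ker_inf {V W : Type*} [AddCommGroup V] [Module ℂ V] [AddCommGroup W]
    [Module ℂ W] (T : V →ₗ[ℂ] W) (p : Submodule ℂ V) [FiniteDimensional ℂ p] :
    Module.finrank ℂ (p.map T) + Module.finrank ℂ (T.ker ⊓ p : Submodule ℂ V)
      = Module.finrank ℂ p := by
  rw [← LinearMap.finrank_range_add_finrank_ker (T.domRestrict p), LinearMap.range_domRestrict,
    LinearMap.ker_domRestrict, ← Submodule.finrank_map_subtype_eq p (T.ker.comap p.subtype),
    Submodule.map_comap_subtype, inf_comm]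

/-- Used for the quotient map, for multiplication by a nonzerodivisor and for localization: each has
kernel K on forms, so each image has dimension `hilb K d`. -/
lemma finrank_map_forms {V : Type*} [AddCommGroup V] [Module ℂ V] {K : Ideal S} {d : ℤ}
    (T : S →ₗ[ℂ] V) (hT : ∀ F ∈ forms d, T F = 0 ↔ F ∈ K) :
    (Module.finrank ℂ ((forms d).map T) : ℤ) = hilb K d := by
  rw [hilb, idealDim, ← finrank_map_add_finrank_ker_inf T (forms d)]
  have : T.ker ⊓ forms d = K.restrictScalars ℂ ⊓ forms d := by
    ext F
    simp only [Submodule.mem_inf, LinearMap.mem_ker, Submodule.restrictScalars_mem]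
    exact and_congr_left fun h => hT F h
  rw [this]
  push_cast
  ring

/-- The quotient map `S → S/K`, as a `ℂ`-linear map. -/
abbrev quot (K : Ideal S) : S →ₗ[ℂ] S ⧸ K := (Ideal.Quotient.mkₐ ℂ K).toLinearMap

lemma quot_eq_zero {K : Ideal S} {F : S} : quot K F = 0 ↔ F ∈ K := by
  simp [quot, Ideal.Quotient.eq_zero_iff_mem]

lemma finrank_map_quot (K : Ideal S) (d : ℤ) :
    (Module.finrank ℂ ((forms d).map (quot K)) : ℤ) = hilb K d :=
  finrank_map_forms _ fun _ _ => quot_eq_zero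

lemma finrank_map_quot_mul {K : Ideal S} {L : S} (h : ∀ F, L * F ∈ K → F ∈ K) (d : ℤ) :
    (Module.finrank ℂ ((forms d).map (quot K ∘ₗ LinearMap.mulLeft ℂ L)) : ℤ) = hilb K d :=
  finrank_map_forms _ fun F _ => by
    rw [LinearMap.comp_apply, LinearMap.mulLeft_apply, quot_eq_zero]
    exact ⟨h F, K.mul_mem_left L⟩

lemma map_quot_mul_le {K : Ideal S} {L : S} {e : ℤ} (hL : L ∈ forms e) (d : ℤ) :
    (forms d).map (quot K ∘ₗ LinearMap.mulLeft ℂ L) ≤ (forms (e + d)).map (quot K) := by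
  rintro _ ⟨F, hF, rfl⟩
  exact ⟨L * F, mul_mem_forms hL hF, rfl⟩

lemma hilb_le_hilb_add {K : Ideal S} {L : S} {e : ℤ} (hL : L ∈ forms e)
    (h : ∀ F, L * F ∈ K → F ∈ K) (d : ℤ) : hilb K d ≤ hilb K (e + d) := by
  rw [← finrank_map_quot_mul h, ← finrank_map_quot K (e + d)]
  exact_mod_cast Submodule.finrank_mono (map_quot_mul_le hL d)

lemma hilb_of_neg (K : Ideal S) {d : ℤ} (hd : d < 0) : hilb K d = 0 := by
  rw [← finrank_map_quot, forms_of_neg hd]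
  simp

variable {J : Ideal S}

lemma IsIdealOfZeroDimScheme.hilb_mono (hJ : IsIdealOfZeroDimScheme J) : Monotone (hilb J) := by
  obtain ⟨ℓ, hℓ, hne⟩ := hJ.exists_linear_nonvanishing
  refine monotone_int_of_le_succ fun d => ?_
  rw [add_comm]
  exact hilb_le_hilb_add hℓ (fun F => hJ.mem_of_mul_mem hne) d

lemma IsIdealOfZeroDimScheme.hilb_zero_pos (hJ : IsIdealOfZeroDimScheme J) : 0 < hilb J 0 := by
  obtain ⟨p, hp⟩ := hJ.nonempty
  rw [← finrank_map_quot, Nat.cast_pos, Module.finrank_pos_iff]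
  refine ⟨⟨⟨quot J 1, 1, isWeightedHomogeneous_one ℂ _, rfl⟩, 0, fun h => ?_⟩⟩
  have h1 : (1 : S) ∈ J := quot_eq_zero.1 (congrArg Subtype.val h)
  simpa using hp 1 h1

/-- The Hilbert function of a zero-dimensional scheme is eventually constant. -/
lemma IsIdealOfZeroDimScheme.exists_degree (hJ : IsIdealOfZeroDimScheme J) :
    ∃ c : ℤ, 0 < c ∧ (∀ d, hilb J d ≤ c) ∧ ∃ N : ℤ, ∀ d, N ≤ d → hilb J d = c := by
  obtain ⟨ℓ, hℓ, hne⟩ := hJ.exists_linear_nonvanishing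
  obtain ⟨N, hN⟩ := hJ.isHomog.exists_forms_sub_mul_mem hne hℓ
  -- Multiplication by ℓ on S/J is injective in all degrees and surjective in large ones.
  have step : ∀ d : ℤ, (N : ℤ) ≤ d → hilb J (d + 1) = hilb J d := by
    intro d hd
    refine le_antisymm ?_ (hJ.hilb_mono (by lia))
    rw [← finrank_map_quot_mul (fun F => hJ.mem_of_mul_mem hne) d, ← finrank_map_quot J (d + 1)]
    refine Int.ofNat_le.2 (Submodule.finrank_mono ?_)
    rintro _ ⟨F, hF, rfl⟩
    rw [add_comm] at hF
    obtain ⟨G, hG, hFG⟩ := hN d (by lia) F hF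
    refine ⟨G, hG, ?_⟩
    rw [← sub_eq_zero, LinearMap.comp_apply, LinearMap.mulLeft_apply, ← map_sub, ← neg_eq_zero,
      ← map_neg, neg_sub, quot_eq_zero]
    exact hFG
  have const : ∀ d : ℤ, (N : ℤ) ≤ d → hilb J d = hilb J N := fun d hd =>
    Int.leInduction rfl (fun d hd ih => (step d hd).trans ih) d hd
  refine ⟨hilb J N, hJ.hilb_zero_pos.trans_le (hJ.hilb_mono (by lia)), fun d => ?_, N, const⟩
  rw [← const (max d N) (le_max_right _ _)]
  exact hJ.hilb_mono (le_max_left _ _)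

/-! ### The Hilbert function from the resolution -/

section Resolution

variable {t : ℕ} {a : Fin (t + 1) → ℤ} {b : Fin t → ℤ} {f : Fin (t + 1) → S}
  {M : Matrix (Fin (t + 1)) (Fin t) S}

/-- The inclusion of a product of spaces of forms in a free module. -/
def piForms {ι : Type*} (c : ι → ℤ) : (∀ i, forms (c i)) →ₗ[ℂ] (ι → S) :=
  LinearMap.pi fun i => (forms (c i)).subtype ∘ₗ LinearMap.proj i

lemma piForms_injective {ι : Type*} (c : ι → ℤ) : Function.Injective (piForms c) :=
  fun _ _ h => funext fun i => Subtype.ext (congrFun h i)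

lemma mem_range_piForms {ι : Type*} {c : ι → ℤ} {v : ι → S} :
    v ∈ (piForms c).range ↔ ∀ i, v i ∈ forms (c i) := by
  constructor
  · rintro ⟨x, rfl⟩ i
    exact (x i).2
  · exact fun h => ⟨fun i => ⟨v i, h i⟩, rfl⟩

lemma linearCombination_comp (hf : ∀ i, f i ∈ forms (a i)) (k : ℤ) (v : Fin (t + 1) → S) :
    comp 1 k (Fintype.linearCombination S f v)
      = Fintype.linearCombination S f fun i => comp 1 (k - a i) (v i) := by
  simp only [Fintype.linearCombination_apply, map_sum, smul_eq_mul]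
  refine Finset.sum_congr rfl fun i _ => ?_
  rw [mul_comm, comp_form_mul_sub (hf i), mul_comm]

lemma mulVec_comp (hM : ∀ i j, M i j ∈ forms (b j - a i)) (k : ℤ) (w : Fin t → S)
    (i : Fin (t + 1)) :
    comp 1 (k - a i) (M.mulVec w i) = M.mulVec (fun j => comp 1 (k - b j) (w j)) i := by
  simp only [Matrix.mulVec, dotProduct, map_sum]
  refine Finset.sum_congr rfl fun j _ => ?_
  rw [comp_form_mul_sub (hM i j), sub_sub_sub_cancel_right]

lemma mulVec_mem_forms (hM : ∀ i j, M i j ∈ forms (b j - a i)) {k : ℤ} {w : Fin t → S}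
    (hw : ∀ j, w j ∈ forms (k - b j)) (i : Fin (t + 1)) : M.mulVec w i ∈ forms (k - a i) := by
  rw [Matrix.mulVec, dotProduct]
  refine sum_mem fun j _ => ?_
  have := mul_mem_forms (hM i j) (hw j)
  rwa [sub_add_sub_cancel'] at this

/-- The dimensions in the graded pieces of a resolution add up. -/
lemma IsMinimalResolution.idealDim_add (h : IsMinimalResolution J a b f M) (k : ℤ) :
    idealDim J k + ∑ j, Module.finrank ℂ (forms (k - b j))
      = ∑ i, Module.finrank ℂ (forms (k - a i)) := by
  have hB : Module.finrank ℂ (∀ j, forms (k - b j)) = ∑ j, Module.finrank ℂ (forms (k - b j)) :=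
    Module.finrank_pi_fintype ℂ
  have hA : Module.finrank ℂ (∀ i, forms (k - a i)) = ∑ i, Module.finrank ℂ (forms (k - a i)) :=
    Module.finrank_pi_fintype ℂ
  set T : (Fin (t + 1) → S) →ₗ[ℂ] S := (Fintype.linearCombination S f).restrictScalars ℂ with hT
  set U : (Fin t → S) →ₗ[ℂ] (Fin (t + 1) → S) := M.mulVecLin.restrictScalars ℂ with hU
  -- A preimage of a homogeneous syzygy under M need not be homogeneous, but its components of the
  -- right degrees form another preimage.
  have hker : (T.ker ⊓ (piForms fun i => k - a i).range : Submodule ℂ (Fin (t + 1) → S))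
      = (U ∘ₗ piForms fun j => k - b j).range := by
    ext v
    rw [Submodule.mem_inf, mem_range_piForms, LinearMap.mem_ker]
    constructor
    · rintro ⟨hv, hvd⟩
      obtain ⟨w, rfl⟩ := (h.exact v).1 hv
      refine ⟨fun j => ⟨comp 1 (k - b j) (w j), comp_mem _ _ _⟩, ?_⟩
      ext1 i
      have h1 := mulVec_comp h.degree_M k w i
      exact h1.symm.trans (comp_of_mem (hvd i))
    · rintro ⟨w, rfl⟩
      exact ⟨(h.exact _).2 ⟨_, rfl⟩, fun i => mulVec_mem_forms h.degree_M (fun j => (w j).2) i⟩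
  have hrange : (piForms fun i => k - a i).range.map T = J.restrictScalars ℂ ⊓ forms k := by
    ext F
    rw [Submodule.mem_inf, Submodule.restrictScalars_mem, ← h.span_f]
    constructor
    · rintro ⟨v, hv, rfl⟩
      rw [SetLike.mem_coe, mem_range_piForms] at hv
      have hTv : T v = ∑ i, v i * f i := by
        simp [hT, Fintype.linearCombination_apply]
      rw [hTv]
      refine ⟨sum_mem fun i _ => Ideal.mul_mem_left _ _ (Ideal.subset_span ⟨i, rfl⟩),
        sum_mem fun i _ => ?_⟩
      have := mul_mem_forms (hv i) (h.degree_f i)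
      rwa [sub_add_cancel] at this
    · rintro ⟨hF, hFk⟩
      rw [Ideal.span, ← Fintype.range_linearCombination] at hF
      obtain ⟨v, rfl⟩ := hF
      refine ⟨fun i => comp 1 (k - a i) (v i), ?_, ?_⟩
      · rw [SetLike.mem_coe, mem_range_piForms]
        exact fun i => comp_mem _ _ _
      · exact (linearCombination_comp h.degree_f k v).symm.trans (comp_of_mem hFk)
  have hUinj : Function.Injective (U ∘ₗ piForms fun j => k - b j) :=
    h.injective.comp (piForms_injective _)
  have key := finrank_map_add_finrank_ker_inf T (piForms fun i => k - a i).range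
  rw [hker, hrange, LinearMap.finrank_range_of_inj hUinj,
    LinearMap.finrank_range_of_inj (piForms_injective _), hA, hB] at key
  exact key

lemma IsMinimalResolution.hilb_eq (h : IsMinimalResolution J a b f M) (k : ℤ) :
    hilb J k = Module.finrank ℂ (forms k) - ∑ i, (Module.finrank ℂ (forms (k - a i)) : ℤ)
      + ∑ j, (Module.finrank ℂ (forms (k - b j)) : ℤ) := by
  have := h.idealDim_add k
  zify at this
  rw [hilb]
  lia

/-- The third difference of the Hilbert function counts the degrees in the resolution. -/
lemma IsMinimalResolution.third_diff_hilb (h : IsMinimalResolution J a b f M) (k : ℤ) :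
    hilb J k - 3 * hilb J (k - 1) + 3 * hilb J (k - 2) - hilb J (k - 3)
      = (if k = 0 then 1 else 0) - ((Finset.univ.filter fun i => a i = k).card : ℤ)
        + ((Finset.univ.filter fun j => b j = k).card : ℤ) := by
  have key : ∀ {ι : Type} [Fintype ι] (c : ι → ℤ),
      ((Finset.univ.filter fun i => c i = k).card : ℤ)
        = ∑ i, (Module.finrank ℂ (forms (k - c i)) : ℤ)
          - 3 * ∑ i, (Module.finrank ℂ (forms (k - 1 - c i)) : ℤ)
          + 3 * ∑ i, (Module.finrank ℂ (forms (k - 2 - c i)) : ℤ)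
          - ∑ i, (Module.finrank ℂ (forms (k - 3 - c i)) : ℤ) := by
    intro ι _ c
    rw [Finset.mul_sum, Finset.mul_sum, ← Finset.sum_sub_distrib, ← Finset.sum_add_distrib,
      ← Finset.sum_sub_distrib, Finset.card_filter, Nat.cast_sum]
    refine Finset.sum_congr rfl fun i _ => ?_
    have := third_diff_finrank_forms (k - c i)
    rw [sub_right_comm k _ 1, sub_right_comm k _ 2, sub_right_comm k _ 3] at this
    rw [this]
    by_cases hi : c i = k
    · simp [hi]
    · rw [if_neg hi, if_neg (by lia)]; rfl
  rw [h.hilb_eq, h.hilb_eq, h.hilb_eq, h.hilb_eq, key a, key b, ← third_diff_finrank_forms k]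
  ring

/-- A minimal resolution with a nonzero syzygy module involves every generator in some syzygy. -/
lemma IsMinimalResolution.exists_ne_zero (h : IsMinimalResolution J a b f M) (ht : 0 < t)
    (i : Fin (t + 1)) : ∃ j, M i j ≠ 0 := by
  by_contra! hM
  have hrow : ∀ v, Fintype.linearCombination S f v = 0 → v i = 0 := by
    intro v hv
    obtain ⟨w, rfl⟩ := (h.exact v).1 hv
    simp [Matrix.mulVec, dotProduct, hM]
  have : Nontrivial (Fin (t + 1)) := Fin.nontrivial_iff_two_le.2 (by lia)
  obtain ⟨k, hk⟩ := exists_ne i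
  -- The Koszul syzygy f_k e_i - f_i e_k has i-th entry f_k, while a zero row i of M kills the i-th
  -- entry of every syzygy.
  have hfk : f k = 0 := by
    have := hrow (f k • Pi.single i 1 - f i • Pi.single k 1) (by
      rw [map_sub, map_smul, map_smul, Fintype.linearCombination_apply_single,
        Fintype.linearCombination_apply_single]
      simp [mul_comm])
    simpa [hk.symm] using this
  -- Now e_k itself is a syzygy, but its entry 1 cannot lie in the irrelevant ideal.
  obtain ⟨w, hw⟩ := (h.exact (Pi.single k 1)).1 (by
    rw [Fintype.linearCombination_apply_single, hfk, smul_zero])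
  have := congrArg constantCoeff (congrFun hw k)
  simp [Matrix.mulVec, dotProduct, h.minimal_M] at this

/-- In a minimal resolution with syzygies, no generator has the maximal degree of a syzygy. -/
lemma IsMinimalResolution.exists_lt (h : IsMinimalResolution J a b f M) (ht : 0 < t)
    (i : Fin (t + 1)) : ∃ j, a i < b j := by
  obtain ⟨j, hj⟩ := h.exists_ne_zero ht i
  refine ⟨j, ?_⟩
  by_contra! hle
  refine hj ?_
  -- A nonzero entry of degree b j - a i ≤ 0 would be a constant, which minimality excludes.
  ext α
  by_contra hα
  have h1 := mem_forms.1 (h.degree_M i j) α hα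
  have h2 : α = 0 := by
    rw [← Finsupp.degree_eq_zero_iff]
    lia
  subst h2
  exact hα (h.minimal_M i j)

end Resolution

/-! ### Freeness of `S` over the subring generated by three general forms -/

section Free

variable {m : ℕ}

/-- The quotients of an exponent by `m`. -/
def divExp (m : ℕ) (α : Fin 3 →₀ ℕ) : Fin 3 →₀ ℕ := α.mapRange (· / m) (Nat.zero_div m)

/-- The remainders of an exponent modulo `m`. -/
def modExp (m : ℕ) (α : Fin 3 →₀ ℕ) : Fin 3 →₀ ℕ := α.mapRange (· % m) (Nat.zero_mod m)

lemma smul_divExp_add_modExp (m : ℕ) (α : Fin 3 →₀ ℕ) : m • divExp m α + modExp m α = α := by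
  ext i
  simp [divExp, modExp, Nat.div_add_mod]

lemma degree_fin_three (α : Fin 3 →₀ ℕ) : α.degree = α 0 + α 1 + α 2 := by
  rw [Finsupp.degree_eq_sum, Fin.sum_univ_three]

lemma divExp_smul_add {γ α : Fin 3 →₀ ℕ} (hm : 0 < m) :
    divExp m (m • γ + α) = γ + divExp m α := by
  ext i
  simp [divExp, Nat.mul_add_div hm]

lemma modExp_smul_add {γ α : Fin 3 →₀ ℕ} : modExp m (m • γ + α) = modExp m α := by
  ext i
  simp [modExp]

/-- The product `g ^ (α / m) * z ^ (α % m)`, which replaces the monomial `z ^ α`. -/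
def twist {R : Type*} [CommRing R] (m : ℕ) (g : Fin 3 → MvPolynomial (Fin 3) R)
    (α : Fin 3 →₀ ℕ) : MvPolynomial (Fin 3) R :=
  aeval g (monomial (divExp m α) (1 : R)) * monomial (modExp m α) 1

lemma map_twist {R R' : Type*} [CommRing R] [CommRing R'] (φ : R →+* R')
    (g : Fin 3 → MvPolynomial (Fin 3) R) (α : Fin 3 →₀ ℕ) :
    map φ (twist m g α) = twist m (fun i => map φ (g i)) α := by
  simp only [twist, aeval_monomial, Finsupp.prod, map_mul, map_prod, map_pow, map_monomial, map_one]

/-- The base point of the genericity argument: for gᵢ = zᵢ^m the twist changes nothing, so its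
determinant is 1. -/
lemma twist_X_pow (α : Fin 3 →₀ ℕ) : twist m (fun i => (X i : S) ^ m) α = monomial α 1 := by
  conv_rhs => rw [← smul_divExp_add_modExp m α]
  rw [twist, aeval_monomial, map_one, one_mul,
    show (monomial (m • divExp m α + modExp m α) (1 : ℂ) : S)
      = monomial (m • divExp m α) 1 * monomial (modExp m α) 1 by simp [monomial_mul]]
  congr 1
  rw [monomial_eq, map_one, one_mul, Finsupp.prod_fintype _ _ (by simp),
    Finsupp.prod_fintype _ _ (by simp)]
  simp [← pow_mul]

variable {g : Fin 3 → S}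

lemma aeval_monomial_mul_twist (hm : 0 < m) (γ α : Fin 3 →₀ ℕ) (c : ℂ) :
    aeval g (monomial γ c) * twist m g α = c • twist m g (m • γ + α) := by
  rw [twist, twist, divExp_smul_add hm, modExp_smul_add, ← mul_assoc, ← map_mul, monomial_mul,
    mul_one, ← smul_mul_assoc, ← map_smul, smul_monomial, smul_eq_mul, mul_one]

/-- Weight m on each variable makes the substitution zᵢ ↦ gᵢ preserve degrees; this is what the
weighted grading is for. -/
lemma aeval_mem_forms (hg : ∀ i, (g i).IsHomogeneous m) {c : ℤ} {F : S} (hF : F ∈ wforms m c) :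
    aeval g F ∈ forms c := by
  rw [F.as_sum, map_sum]
  refine sum_mem fun α hα => ?_
  have h := mem_wforms.1 hF α (mem_support_iff.1 hα)
  have hα : (aeval g (monomial α (1 : ℂ)) : S).IsHomogeneous (m * α.degree) :=
    (isHomogeneous_monomial (d := α) (1 : ℂ) rfl).aeval g hg
  have h2 : aeval g (monomial α (1 : ℂ)) ∈ forms c := by
    have := mem_forms_natCast.2 hα
    rwa [Nat.cast_mul, mul_comm, h] at this
  rw [← mul_one (coeff α F), ← smul_eq_mul, ← smul_monomial, map_smul]
  exact Submodule.smul_mem _ _ h2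

lemma twist_mem_forms (hg : ∀ i, (g i).IsHomogeneous m) (α : Fin 3 →₀ ℕ) :
    twist m g α ∈ forms α.degree := by
  have h1 : (monomial (divExp m α) (1 : ℂ) : S) ∈ wforms m ((divExp m α).degree * m) :=
    isWeightedHomogeneous_monomial _ _ _ (weight_const _ _)
  have h2 := mul_mem_forms (aeval_mem_forms hg h1) (monomial_mem_forms (modExp m α) 1)
  have hdeg : (α.degree : ℤ) = (divExp m α).degree * m + (modExp m α).degree := by
    conv_lhs => rw [← smul_divExp_add_modExp m α]
    simp [mul_comm]
  rwa [hdeg]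

/-- The linear map that sends `z ^ α` to `g ^ (α / m) * z ^ (α % m)`. -/
def twistMap (m : ℕ) (g : Fin 3 → S) : S →ₗ[ℂ] S :=
  (basisMonomials (Fin 3) ℂ).constr ℂ (twist m g)

lemma twistMap_monomial (α : Fin 3 →₀ ℕ) (c : ℂ) :
    twistMap m g (monomial α c) = c • twist m g α := by
  have h := (basisMonomials (Fin 3) ℂ).constr_basis ℂ (twist m g) α
  rw [coe_basisMonomials] at h
  rw [← mul_one c, ← smul_eq_mul, ← smul_monomial, map_smul, twistMap, h, smul_eq_mul, mul_one]

lemma linearMap_ext_monomial {V : Type*} [AddCommGroup V] [Module ℂ V] {A B : S →ₗ[ℂ] V}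
    (h : ∀ α, A (monomial α 1) = B (monomial α 1)) : A = B :=
  (basisMonomials (Fin 3) ℂ).ext fun α => by simpa using h α

lemma comp_twistMap (hg : ∀ i, (g i).IsHomogeneous m) (d : ℤ) (F : S) :
    comp 1 d (twistMap m g F) = twistMap m g (comp 1 d F) := by
  suffices comp 1 d ∘ₗ twistMap m g = twistMap m g ∘ₗ comp 1 d from LinearMap.congr_fun this F
  refine linearMap_ext_monomial fun α => ?_
  rw [LinearMap.comp_apply, LinearMap.comp_apply, twistMap_monomial, one_smul,
    weightedHomogeneousComponent_of_mem (twist_mem_forms hg α),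
    weightedHomogeneousComponent_of_mem (monomial_mem_forms α 1)]
  split_ifs
  · rw [twistMap_monomial, one_smul]
  · rw [map_zero]

lemma mul_mem_range_twistMap (hm : 0 < m) (F : S) {G : S} (hG : G ∈ (twistMap m g).range) :
    aeval g F * G ∈ (twistMap m g).range := by
  obtain ⟨H, rfl⟩ := hG
  rw [F.as_sum, H.as_sum, map_sum, map_sum, Finset.sum_mul_sum]
  refine sum_mem fun γ _ => sum_mem fun α _ => ?_
  rw [twistMap_monomial, mul_smul_comm, aeval_monomial_mul_twist hm]
  refine Submodule.smul_mem _ _ (Submodule.smul_mem _ _ ⟨monomial (m • γ + α) 1, ?_⟩)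
  rw [twistMap_monomial, one_smul]

/-- The range is stable under multiplication by ℂ[g₀, g₁, g₂]. It therefore suffices to reach zᵢ
times a reduced monomial, whose degree is at most 3(m - 1) + 1 ≤ 3m. -/
lemma twistMap_surjective (hm : 0 < m)
    (h : ∀ α : Fin 3 →₀ ℕ, α.degree ≤ 3 * m → monomial α 1 ∈ (twistMap m g).range) :
    Function.Surjective (twistMap m g) := by
  rw [← LinearMap.range_eq_top, eq_top_iff]
  rintro F -
  induction F using MvPolynomial.induction_on with
  | C c =>
    have := Submodule.smul_mem _ c (h 0 (by simp))
    rwa [smul_monomial, smul_eq_mul, mul_one] at this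
  | add F G hF hG => exact add_mem hF hG
  | mul_X F i hF =>
    obtain ⟨H, rfl⟩ := hF
    rw [H.as_sum, map_sum, Finset.sum_mul]
    refine sum_mem fun α _ => ?_
    rw [twistMap_monomial, smul_mul_assoc, twist, mul_assoc]
    refine Submodule.smul_mem _ _ (mul_mem_range_twistMap hm _ ?_)
    rw [X, monomial_mul, mul_one]
    refine h _ ?_
    have hα : ∀ k, modExp m α k < m := fun k => Nat.mod_lt _ hm
    have h1 : (modExp m α + Finsupp.single i 1).degree = (modExp m α).degree + 1 := by simp
    rw [h1, degree_fin_three]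
    have := hα 0
    have := hα 1
    have := hα 2
    lia

/-- The map preserves degrees and each S_d is finite-dimensional, so surjectivity gives injectivity
degree by degree. -/
lemma twistMap_injective (hg : ∀ i, (g i).IsHomogeneous m)
    (h : Function.Surjective (twistMap m g)) : Function.Injective (twistMap m g) := by
  have hpres : ∀ d : ℤ, ∀ F ∈ forms d, twistMap m g F ∈ forms d := by
    intro d F hF
    have := comp_twistMap hg d F
    rw [comp_of_mem hF] at this
    rw [← this]
    exact comp_mem _ _ _
  have hinj : ∀ d : ℤ, Function.Injective ((twistMap m g).restrict (hpres d)) := by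
    intro d
    rw [LinearMap.injective_iff_surjective]
    intro F
    obtain ⟨G, hG⟩ := h F
    refine ⟨⟨comp 1 d G, comp_mem _ _ _⟩, Subtype.ext ?_⟩
    rw [LinearMap.coe_restrict_apply, ← comp_twistMap hg, hG]
    exact comp_of_mem F.2
  rw [← LinearMap.ker_eq_bot, LinearMap.ker_eq_bot']
  intro F hF
  refine eq_zero_of_comp (w := 1) fun d => ?_
  have h0 := comp_twistMap hg d F
  rw [hF, map_zero] at h0
  exact congrArg Subtype.val (@hinj d ⟨comp 1 d F, comp_mem _ _ _⟩ 0 (by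
    ext1
    simpa using h0.symm))

/-! ### The genericity condition -/

/-- The exponents of degree at most `N`. -/
def expsLE (N : ℕ) : Finset (Fin 3 →₀ ℕ) :=
  (Finset.range (N + 1)).biUnion fun d => Finset.univ.finsuppAntidiag d

lemma mem_expsLE {N : ℕ} {α : Fin 3 →₀ ℕ} : α ∈ expsLE N ↔ α.degree ≤ N := by
  simp [expsLE, Finset.mem_finsuppAntidiag, Finsupp.degree_eq_sum]

/-- The coefficients of the polynomials `twist m g α`, for all exponents of degree at most `3m`. -/
def twistMatrix {R : Type*} [CommRing R] (m : ℕ) (g : Fin 3 → MvPolynomial (Fin 3) R) :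
    Matrix (expsLE (3 * m)) (expsLE (3 * m)) R :=
  Matrix.of fun α β => coeff β.1 (twist m g α.1)

/-- Three forms of degree `m` with indeterminate coefficients. -/
def genericForm (m : ℕ) (i : Fin 3) :
    MvPolynomial (Fin 3) (MvPolynomial (Fin 3 × (Fin 3 →₀ ℕ)) ℂ) :=
  ∑ γ ∈ (Finset.univ : Finset (Fin 3)).finsuppAntidiag m, monomial γ (X (i, γ))

lemma map_genericForm (hg : ∀ i, (g i).IsHomogeneous m) (i : Fin 3) :
    map (eval fun q : Fin 3 × (Fin 3 →₀ ℕ) => coeff q.2 (g q.1)) (genericForm m i) = g i := by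
  simp only [genericForm, map_sum, map_monomial, eval_X]
  ext α
  rw [coeff_sum]
  simp only [coeff_monomial, Finset.sum_ite_eq']
  split_ifs with h
  · rfl
  · by_contra hα
    refine h ?_
    have := mem_forms.1 (mem_forms_natCast.2 (hg i)) α (Ne.symm hα)
    rw [Finset.mem_finsuppAntidiag, ← Finsupp.degree_eq_sum]
    exact ⟨by exact_mod_cast this, Finset.subset_univ _⟩

lemma eval_det_twistMatrix (hg : ∀ i, (g i).IsHomogeneous m) :
    eval (fun q : Fin 3 × (Fin 3 →₀ ℕ) => coeff q.2 (g q.1)) (twistMatrix m (genericForm m)).det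
      = (twistMatrix m g).det := by
  rw [RingHom.map_det]
  congr 1
  ext α β
  rw [RingHom.mapMatrix_apply, Matrix.map_apply, twistMatrix, twistMatrix, Matrix.of_apply,
    Matrix.of_apply, ← coeff_map, map_twist]
  simp only [map_genericForm hg]

lemma monomial_mem_range_twistMap (hg : ∀ i, (g i).IsHomogeneous m)
    (hdet : (twistMatrix m g).det ≠ 0) {β : Fin 3 →₀ ℕ} (hβ : β.degree ≤ 3 * m) :
    monomial β 1 ∈ (twistMap m g).range := by
  have hinv : (twistMatrix m g)⁻¹ * twistMatrix m g = 1 :=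
    Matrix.nonsing_inv_mul _ (Ne.isUnit hdet)
  let b : expsLE (3 * m) := ⟨β, mem_expsLE.2 hβ⟩
  have key : (monomial β 1 : S) = ∑ α, (twistMatrix m g)⁻¹ b α • twist m g α.1 := by
    ext γ
    rw [coeff_sum]
    simp only [coeff_smul, smul_eq_mul]
    by_cases hγ : γ ∈ expsLE (3 * m)
    · have := congrFun (congrFun hinv b) ⟨γ, hγ⟩
      rw [Matrix.mul_apply, Matrix.one_apply] at this
      simp only [twistMatrix, Matrix.of_apply] at this ⊢
      rw [this, coeff_monomial]
      simp [b]
    · rw [mem_expsLE] at hγ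
      rw [coeff_monomial, if_neg (by rintro rfl; exact hγ hβ)]
      -- The twists indexed by the matrix are homogeneous of degree at most 3m, so they have no
      -- coefficients outside its columns.
      refine (Finset.sum_eq_zero fun α _ => ?_).symm
      by_contra h
      have := mem_forms.1 (twist_mem_forms hg α.1) γ (right_ne_zero_of_mul h)
      have := mem_expsLE.1 α.2
      lia
  rw [key]
  refine sum_mem fun α _ => Submodule.smul_mem _ _ ⟨monomial α.1 1, ?_⟩
  rw [twistMap_monomial, one_smul]

/-! ### Decomposition of polynomials -/

/-- A vector of exponents smaller than `m`. -/
def smallExp (e : Fin 3 → Fin m) : Fin 3 →₀ ℕ := Finsupp.equivFunOnFinite.symm fun i => (e i : ℕ)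

lemma smallExp_apply (e : Fin 3 → Fin m) (i : Fin 3) : smallExp e i = e i := rfl

/-- The linear map `(F_e) ↦ ∑ F_e(g) z ^ e`, where `e` runs through the exponents smaller than `m`. -/
def assemble (m : ℕ) (g : Fin 3 → S) : ((Fin 3 → Fin m) → S) →ₗ[ℂ] S :=
  ∑ e : Fin 3 → Fin m, LinearMap.mulRight ℂ (monomial (smallExp e) (1 : ℂ)) ∘ₗ
    (aeval g : S →ₐ[ℂ] S).toLinearMap ∘ₗ LinearMap.proj e

lemma assemble_apply (F : (Fin 3 → Fin m) → S) :
    assemble m g F = ∑ e, aeval g (F e) * monomial (smallExp e) 1 := by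
  simp [assemble]

lemma assemble_single (e : Fin 3 → Fin m) (F : S) :
    assemble m g (Pi.single e F) = aeval g F * monomial (smallExp e) 1 := by
  rw [assemble_apply, Finset.sum_eq_single e]
  · simp
  · intro e' _ h
    simp [h]
  · simp

lemma divExp_smallExp (e : Fin 3 → Fin m) : divExp m (smallExp e) = 0 := by
  ext i
  simp [divExp, smallExp_apply]

lemma modExp_smallExp (e : Fin 3 → Fin m) : modExp m (smallExp e) = smallExp e := by
  ext i
  simp [modExp, smallExp_apply, Nat.mod_eq_of_lt]

lemma aeval_monomial_mul_smallExp (hm : 0 < m) (e : Fin 3 → Fin m) (γ : Fin 3 →₀ ℕ) :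
    aeval g (monomial γ (1 : ℂ)) * monomial (smallExp e) 1
      = twist m g (m • γ + smallExp e) := by
  rw [twist, divExp_smul_add hm, modExp_smul_add, divExp_smallExp, modExp_smallExp, add_zero]

lemma assemble_ext {V : Type*} [AddCommGroup V] [Module ℂ V] {A B : ((Fin 3 → Fin m) → S) →ₗ[ℂ] V}
    (h : ∀ e γ, A (Pi.single e (monomial γ 1)) = B (Pi.single e (monomial γ 1))) : A = B :=
  LinearMap.pi_ext' fun e => linearMap_ext_monomial fun γ => h e γ

/-- For gᵢ = zᵢ^m, `assemble` merely sorts monomials by exponents modulo m. The general case factors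
through this one by `twistMap`, so injectivity transfers. -/
lemma twistMap_assemble (hm : 0 < m) (F : (Fin 3 → Fin m) → S) :
    twistMap m g (assemble m (fun i => X i ^ m) F) = assemble m g F := by
  suffices twistMap m g ∘ₗ assemble m (fun i => X i ^ m) = assemble m g from
    LinearMap.congr_fun this F
  refine assemble_ext fun e γ => ?_
  rw [LinearMap.comp_apply, assemble_single, assemble_single, aeval_monomial_mul_smallExp hm,
    aeval_monomial_mul_smallExp hm, twist_X_pow, twistMap_monomial, one_smul]

lemma coeff_assemble (hm : 0 < m) (F : (Fin 3 → Fin m) → S) (e : Fin 3 → Fin m)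
    (γ : Fin 3 →₀ ℕ) :
    coeff (m • γ + smallExp e) (assemble m (fun i => X i ^ m) F) = coeff γ (F e) := by
  suffices lcoeff ℂ (m • γ + smallExp e) ∘ₗ assemble m (fun i => X i ^ m)
      = lcoeff ℂ γ ∘ₗ LinearMap.proj e from LinearMap.congr_fun this F
  refine assemble_ext fun e' γ' => ?_
  rw [LinearMap.comp_apply, LinearMap.comp_apply, assemble_single, aeval_monomial_mul_smallExp hm,
    twist_X_pow, LinearMap.proj_apply, lcoeff_apply, lcoeff_apply, coeff_monomial]
  by_cases he : e' = e
  · subst he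
    rw [Pi.single_eq_same, coeff_monomial]
    congr 1
    rw [add_left_inj, eq_iff_iff]
    refine ⟨fun h => ?_, fun h => by rw [h]⟩
    ext i
    have := DFunLike.congr_fun h i
    simpa [hm.ne'] using this
  · rw [Pi.single_eq_of_ne (Ne.symm he), coeff_zero, if_neg]
    intro h
    refine he (funext fun i => Fin.ext ?_)
    have := congrArg (fun α => modExp m α i) h
    simpa [modExp_smul_add, modExp_smallExp, smallExp_apply] using this

lemma assemble_surjective (hm : 0 < m) (h : Function.Surjective (twistMap m g)) :
    Function.Surjective (assemble m g) := by
  intro F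
  obtain ⟨G, rfl⟩ := h F
  rw [← LinearMap.mem_range, G.as_sum, map_sum]
  refine sum_mem fun α _ => ?_
  rw [twistMap_monomial]
  refine Submodule.smul_mem _ _ ⟨Pi.single (fun i => ⟨α i % m, Nat.mod_lt _ hm⟩)
    (monomial (divExp m α) 1), ?_⟩
  rw [assemble_single, twist]
  congr 2
  exact congrArg monomial (Finsupp.ext fun i => rfl)

lemma assemble_injective (hm : 0 < m) (h : Function.Injective (twistMap m g)) :
    Function.Injective (assemble m g) := by
  rw [← LinearMap.ker_eq_bot, LinearMap.ker_eq_bot']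
  intro F hF
  rw [← twistMap_assemble hm] at hF
  have h0 := h (hF.trans (map_zero _).symm)
  ext e γ
  rw [← coeff_assemble hm F e γ, h0]
  simp

/-- For general `g`, the ring `S` is free over itself via `zᵢ ↦ gᵢ`. -/
lemma forGeneral_assemble_bijective (hm : 0 < m) :
    ForGeneral m fun g => Function.Bijective (assemble m g) := by
  refine ⟨(twistMatrix m (genericForm m)).det, ⟨fun i => X i ^ m, ?_, ?_⟩, ?_⟩
  · exact fun i => isHomogeneous_X_pow i m
  · rw [eval_det_twistMatrix fun i => isHomogeneous_X_pow i m]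
    have : twistMatrix m (fun i => (X i : S) ^ m) = 1 := by
      ext α β
      rw [twistMatrix, Matrix.of_apply, twist_X_pow, coeff_monomial, Matrix.one_apply]
      by_cases h : α = β
      · rw [if_pos h, if_pos (congrArg Subtype.val h)]
      · rw [if_neg h, if_neg fun h' => h (Subtype.ext h')]
    rw [this, Matrix.det_one]
    exact one_ne_zero
  · intro g hg hdet
    rw [eval_det_twistMatrix hg] at hdet
    have hsurj := twistMap_surjective hm fun α => monomial_mem_range_twistMap hg hdet
    exact ⟨assemble_injective hm (twistMap_injective hg hsurj), assemble_surjective hm hsurj⟩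

end Free

/-! ### The defect in terms of the Hilbert function -/

section Defect

variable {K : Ideal S}

lemma toLoc_eq (F : S) :
    toLoc K F = algebraMap (S ⧸ K) (LocRing K) (Ideal.Quotient.mk K F) := rfl

lemma isUnit_toLoc {H : S} (hH : H ∈ nonvanishing K) : IsUnit (toLoc K H) :=
  IsLocalization.map_units (LocRing K)
    (⟨Ideal.Quotient.mk K H, H, hH, rfl⟩ : (nonvanishing K).map (Ideal.Quotient.mk K))

lemma toLoc_eq_zero_of_mem {F : S} (hF : F ∈ K) : toLoc K F = 0 := by
  rw [toLoc_eq, Ideal.Quotient.eq_zero_iff_mem.2 hF, map_zero]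

lemma toLoc_eq_of_sub_mem {F G : S} (h : F - G ∈ K) : toLoc K F = toLoc K G := by
  rw [← sub_eq_zero, ← map_sub, toLoc_eq_zero_of_mem h]

variable {L : S} {m : ℕ}

lemma mem_of_pow_mul_mem (h : ∀ F, L * F ∈ K → F ∈ K) (k : ℕ) {F : S} (hF : L ^ k * F ∈ K) :
    F ∈ K := by
  induction k with
  | zero => simpa using hF
  | succ k ih => exact ih (h _ (by rwa [← mul_assoc, ← pow_succ']))

/-- A power of `L` is, modulo `K`, a multiple of a given form that vanishes at no point of `Z(K)`. -/
lemma IsHomog.exists_pow_sub_mul_mem (hK : IsHomog K) (hm : 0 < m) (hL : L ∈ forms m) {H : S}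
    {e : ℤ} (hH : H ∈ nonvanishing K) (he : H ∈ forms e) :
    ∃ N : ℕ, ∀ k, N ≤ k → ∃ G ∈ forms (k * m - e), L ^ k - H * G ∈ K := by
  obtain ⟨N, hN⟩ := hK.exists_forms_sub_mul_mem hH he
  refine ⟨N, fun k hk => ?_⟩
  have hLk := pow_mem_forms hL k
  refine hN (k * m - e) ?_ (L ^ k) (by rwa [add_sub_cancel])
  rw [add_sub_cancel]
  have : N ≤ k * m := hk.trans (Nat.le_mul_of_pos_right k hm)
  exact_mod_cast this

/-- If H kills F modulo K, then so does a power of L, which is a multiple of H modulo K; and L is a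
nonzerodivisor. -/
lemma IsHomog.toLoc_eq_zero (hK : IsHomog K) (hm : 0 < m) (hL : L ∈ forms m)
    (h : ∀ F, L * F ∈ K → F ∈ K) {F : S} : toLoc K F = 0 ↔ F ∈ K := by
  refine ⟨fun hF => ?_, toLoc_eq_zero_of_mem⟩
  rw [toLoc_eq, IsLocalization.map_eq_zero_iff ((nonvanishing K).map (Ideal.Quotient.mk K))] at hF
  obtain ⟨⟨_, H, hH, rfl⟩, hHF⟩ := hF
  have hHF' : H * F ∈ K := by
    rw [← Ideal.Quotient.eq_zero_iff_mem, map_mul]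
    exact hHF
  obtain ⟨e, he⟩ := hH.1
  obtain ⟨N, hN⟩ := hK.exists_pow_sub_mul_mem hm hL hH he
  obtain ⟨G, -, hG⟩ := hN N le_rfl
  refine mem_of_pow_mul_mem h N ?_
  have : L ^ N * F = (L ^ N - H * G) * F + G * (H * F) := by ring
  rw [this]
  exact add_mem (K.mul_mem_right _ hG) (K.mul_mem_left _ hHF')

lemma IsHomog.exists_forms_sub_pow_mul_mem (hK : IsHomog K) (hL : L ∈ forms m)
    (hne : L ∈ nonvanishing K) :
    ∃ N : ℕ, ∀ (r : ℕ) (d : ℤ), (N : ℤ) ≤ d → ∀ F ∈ forms (r * m + d),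
      ∃ G ∈ forms d, F - L ^ r * G ∈ K := by
  obtain ⟨N, hN⟩ := hK.exists_forms_sub_mul_mem hne hL
  refine ⟨N, fun r d hd => ?_⟩
  induction r with
  | zero => exact fun F hF => ⟨F, by simpa using hF, by simp⟩
  | succ r ih =>
    intro F hF
    rw [show ((r + 1 : ℕ) : ℤ) * m + d = m + (r * m + d) by push_cast; ring] at hF
    have h0 : (0 : ℤ) ≤ r * m := by positivity
    obtain ⟨G, hG, hFG⟩ := hN (r * m + d) (by lia) F hF
    obtain ⟨G', hG', hGG'⟩ := ih G hG
    refine ⟨G', hG', ?_⟩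
    have : F - L ^ (r + 1) * G' = (F - L * G) + L * (G - L ^ r * G') := by ring
    rw [this]
    exact add_mem hFG (K.mul_mem_left _ hGG')

/-- All sections of `𝒪_Z(d)` have the denominator `L ^ N`, for a fixed large `N`. -/
lemma IsHomog.exists_sections_eq_map (hK : IsHomog K) (hm : 0 < m) (hL : L ∈ forms m)
    (hne : L ∈ nonvanishing K) (d : ℤ) :
    ∃ N₀ : ℕ, ∀ N : ℕ, N₀ ≤ N → ∀ u : LocRing K, u * toLoc K (L ^ N) = 1 →
      sections K d = (forms (N * m + d)).map (LinearMap.mulLeft ℂ u ∘ₗ (toLoc K).toLinearMap) := by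
  obtain ⟨N₁, hN₁⟩ := hK.exists_forms_sub_pow_mul_mem hL hne
  refine ⟨N₁ + d.natAbs, fun N hN u hu => ?_⟩
  have hNd : (N₁ : ℤ) ≤ N * m + d := by
    have : N ≤ N * m := Nat.le_mul_of_pos_right N hm
    zify at this
    lia
  ext x
  constructor
  · rintro ⟨e, H, hH, F, hF, hHe, hx⟩
    -- Modulo K, L^(N₂+N) = H G, so x = F/H = G F / L^(N₂+N). The degree of G F is large enough to
    -- divide it by L^N₂, leaving the denominator L^N.
    obtain ⟨N₂, hN₂⟩ := hK.exists_pow_sub_mul_mem hm hL hH hHe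
    obtain ⟨G, hG, hLG⟩ := hN₂ (N₂ + N) (by lia)
    have hGF := mul_mem_forms hG hF
    rw [show ((N₂ + N : ℕ) : ℤ) * m - e + (d + e) = N₂ * m + (N * m + d) by push_cast; ring]
      at hGF
    obtain ⟨F', hF', hFF'⟩ := hN₁ N₂ (N * m + d) hNd _ hGF
    refine ⟨F', hF', ?_⟩
    have h1 : toLoc K (L ^ (N₂ + N)) * x = toLoc K (L ^ N₂ * F') := by
      rw [toLoc_eq_of_sub_mem hLG, ← toLoc_eq_of_sub_mem hFF', map_mul, map_mul, ← hx]
      ring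
    rw [pow_add, map_mul, map_mul, mul_assoc] at h1
    have h2 := (isUnit_toLoc (pow_mem hne N₂)).mul_left_cancel h1
    change u * toLoc K F' = x
    rw [← h2, ← mul_assoc, hu, one_mul]
  · rintro ⟨F, hF, rfl⟩
    refine ⟨N * m, L ^ N, pow_mem hne N, F, by rwa [add_comm], pow_mem_forms hL N, ?_⟩
    change toLoc K (L ^ N) * (u * toLoc K F) = toLoc K F
    rw [← mul_assoc, mul_comm _ u, hu, one_mul]

lemma map_toLoc_le_sections (d : ℤ) : (forms d).map (toLoc K).toLinearMap ≤ sections K d := by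
  rintro _ ⟨F, hF, rfl⟩
  exact ⟨0, 1, one_mem _, F, by simpa using hF, isWeightedHomogeneous_one ℂ _, by simp⟩

/-- Division by L^N identifies the degree Nm + d part of S/K with the sections, and the kernel of
evaluation is K in degree d. -/
lemma IsHomog.exists_defect_eq (hK : IsHomog K) (hm : 0 < m) (hL : L ∈ forms m)
    (hne : L ∈ nonvanishing K) (h : ∀ F, L * F ∈ K → F ∈ K) (d : ℤ) :
    ∃ N₀ : ℕ, ∀ N : ℕ, N₀ ≤ N → (defect K d : ℤ) = hilb K (N * m + d) - hilb K d := by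
  obtain ⟨N₀, hN₀⟩ := hK.exists_sections_eq_map hm hL hne d
  refine ⟨N₀, fun N hN => ?_⟩
  obtain ⟨u, hu⟩ := (isUnit_toLoc (pow_mem hne N)).exists_left_inv
  have hsec := hN₀ N hN u hu
  have h1 : (Module.finrank ℂ (sections K d) : ℤ) = hilb K (N * m + d) := by
    rw [hsec]
    refine finrank_map_forms _ fun F _ => ?_
    rw [← hK.toLoc_eq_zero hm hL h]
    change u * toLoc K F = 0 ↔ _
    exact (IsUnit.of_mul_eq_one _ hu).mul_right_eq_zero
  have h2 : (Module.finrank ℂ ((forms d).map (toLoc K).toLinearMap) : ℤ) = hilb K d :=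
    finrank_map_forms _ fun F _ => hK.toLoc_eq_zero hm hL h
  have : FiniteDimensional ℂ (sections K d) := by
    rw [hsec]
    infer_instance
  have h3 := Submodule.finrank_quotient_add_finrank
    (((forms d).map (toLoc K).toLinearMap).submoduleOf (sections K d))
  have h4 : Module.finrank ℂ (((forms d).map (toLoc K).toLinearMap).submoduleOf (sections K d))
      = Module.finrank ℂ ((forms d).map (toLoc K).toLinearMap) := by
    have h5 : (((forms d).map (toLoc K).toLinearMap).submoduleOf (sections K d)).map
        (sections K d).subtype = (forms d).map (toLoc K).toLinearMap :=
      (Submodule.map_comap_subtype _ _).trans (inf_eq_right.2 (map_toLoc_le_sections d))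
    rw [← Submodule.finrank_map_subtype_eq (sections K d), h5]
  rw [← h1, ← h2, ← h3, h4, defect]
  push_cast
  ring

end Defect

/-! ### The pullback of an ideal along general forms -/

section Pullback

variable {m : ℕ} {g : Fin 3 → S} {J : Ideal S}

lemma aeval_mul_assemble (A : S) (F : (Fin 3 → Fin m) → S) :
    aeval g A * assemble m g F = assemble m g fun e => A * F e := by
  simp only [assemble_apply, Finset.mul_sum, map_mul, mul_assoc]

/-- The pullback is the extension of I along zᵢ ↦ gᵢ. Since S is free along this map, membership is
tested on the coordinates. -/
lemma assemble_mem_pullback_iff (hb : Function.Bijective (assemble m g)) (I : Ideal S)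
    (F : (Fin 3 → Fin m) → S) : assemble m g F ∈ pullback g I ↔ ∀ e, F e ∈ I := by
  constructor
  · intro h
    obtain ⟨n, c, y, hsum⟩ := Submodule.mem_span_set'.1 h
    choose f hf hfy using fun i => (y i).2
    choose A hA using fun i => hb.2 (c i)
    have : F = ∑ i, fun e => f i * A i e := by
      refine hb.1 ?_
      rw [← hsum, map_sum]
      refine Finset.sum_congr rfl fun i _ => ?_
      rw [← aeval_mul_assemble, hA, ← hfy i, smul_eq_mul, mul_comm]
    intro e
    rw [this, Finset.sum_apply]
    exact sum_mem fun i _ => I.mul_mem_right _ (hf i)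
  · intro h
    rw [assemble_apply]
    exact sum_mem fun e _ => Ideal.mul_mem_right _ _ (Ideal.mem_map_of_mem _ (h e))

lemma comp_assemble (hm : 0 < m) (hg : ∀ i, (g i).IsHomogeneous m) (d : ℤ)
    (F : (Fin 3 → Fin m) → S) :
    comp 1 d (assemble m g F)
      = assemble m g fun e => comp m (d - (smallExp e).degree) (F e) := by
  suffices comp 1 d ∘ₗ assemble m g = assemble m g ∘ₗ
      LinearMap.pi fun e => comp m (d - (smallExp e).degree) ∘ₗ LinearMap.proj e from
    LinearMap.congr_fun this F
  refine assemble_ext fun e γ => ?_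
  have h1 : (LinearMap.pi fun e : Fin 3 → Fin m =>
      comp m (d - (smallExp e).degree) ∘ₗ LinearMap.proj e) (Pi.single e (monomial γ 1))
      = Pi.single e (comp m (d - (smallExp e).degree) (monomial γ 1)) := by
    ext1 e'
    by_cases he : e' = e
    · subst he
      simp
    · simp [he]
  have h2 : (monomial γ (1 : ℂ) : S) ∈ wforms m (γ.degree * m) :=
    isWeightedHomogeneous_monomial _ _ _ (weight_const _ _)
  rw [LinearMap.comp_apply, LinearMap.comp_apply, h1, assemble_single, assemble_single,
    weightedHomogeneousComponent_of_mem h2, aeval_monomial_mul_smallExp hm,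
    weightedHomogeneousComponent_of_mem (twist_mem_forms hg _)]
  have h3 : ((m • γ + smallExp e).degree : ℤ) = γ.degree * m + (smallExp e).degree := by
    simp [mul_comm]
  rw [h3]
  by_cases hd : d = γ.degree * m + (smallExp e).degree
  · rw [if_pos hd, if_pos (by lia), aeval_monomial_mul_smallExp hm]
  · rw [if_neg hd, if_neg (by lia), map_zero, zero_mul]

lemma IsHomog.comp_mem_of_mem (hJ : IsHomog J) (hm : 0 < m) {F : S} (hF : F ∈ J) (c : ℤ) :
    comp m c F ∈ J := by
  by_cases h : (m : ℤ) ∣ c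
  · obtain ⟨q, rfl⟩ := h
    rw [comp_mul (by lia)]
    exact hJ F hF q
  · rw [comp_of_not_dvd h]
    exact zero_mem _

lemma IsHomog.pullback (hJ : IsHomog J) (hm : 0 < m) (hg : ∀ i, (g i).IsHomogeneous m)
    (hb : Function.Bijective (assemble m g)) : IsHomog (pullback g J) := by
  intro F hF d
  obtain ⟨A, rfl⟩ := hb.2 F
  rw [assemble_mem_pullback_iff hb] at hF
  rw [comp_assemble hm hg, assemble_mem_pullback_iff hb]
  exact fun e => hJ.comp_mem_of_mem hm (hF e) _

lemma mem_of_aeval_mul_mem_pullback (hb : Function.Bijective (assemble m g)) {ℓ : S}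
    (h : ∀ F, ℓ * F ∈ J → F ∈ J) {F : S} (hF : aeval g ℓ * F ∈ pullback g J) :
    F ∈ pullback g J := by
  obtain ⟨A, rfl⟩ := hb.2 F
  rw [aeval_mul_assemble, assemble_mem_pullback_iff hb] at hF
  rw [assemble_mem_pullback_iff hb]
  exact fun e => h _ (hF e)

lemma eval_aeval (v : Fin 3 → ℂ) (F : S) :
    eval v (aeval g F) = eval (fun i => eval v (g i)) F := by
  have : (aeval v).comp (aeval g) = (aeval fun i => eval v (g i) : S →ₐ[ℂ] ℂ) := by
    ext i
    simp [aeval_eq_eval]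
  exact DFunLike.congr_fun this F

lemma degree_smallExp_add_three_le (e : Fin 3 → Fin m) : (smallExp e).degree + 3 ≤ 3 * m := by
  rw [degree_fin_three]
  simp only [smallExp_apply]
  have := (e 0).2
  have := (e 1).2
  have := (e 2).2
  lia

/-- General forms have no common zero in the projective plane. -/
lemma exists_eval_ne_zero (hm : 0 < m) (hg : ∀ i, (g i).IsHomogeneous m)
    (hb : Function.Bijective (assemble m g)) {v : Fin 3 → ℂ} (hv : v ≠ 0) :
    (fun i => eval v (g i)) ≠ 0 := by
  intro h
  refine hv (funext fun i => ?_)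
  -- The degree 3m exceeds every |e| ≤ 3m - 3, so the coordinates of zᵢ^(3m) have no constant term.
  -- They vanish at g(v) = 0, whence vᵢ = 0.
  obtain ⟨A, hA⟩ := hb.2 (X i ^ (3 * m))
  have hX : (X i ^ (3 * m) : S) ∈ forms (3 * m : ℕ) :=
    mem_forms_natCast.2 (isHomogeneous_X_pow i _)
  have h1 := comp_of_mem hX
  rw [← hA, comp_assemble hm hg, hA] at h1
  have h2 := congrArg (eval v) h1
  rw [assemble_apply, map_sum, Finset.sum_eq_zero, map_pow, eval_X] at h2
  · exact pow_eq_zero_iff (by lia) |>.1 h2.symm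
  · intro e _
    have hc := degree_smallExp_add_three_le e
    rw [map_mul, eval_aeval, h, eval_zero, constantCoeff_eq, coeff_comp,
      if_neg, zero_mul]
    simp only [map_zero, Nat.cast_zero, zero_mul]
    lia

lemma aeval_mem_nonvanishing (hJ : IsHomog J) (hm : 0 < m) (hg : ∀ i, (g i).IsHomogeneous m)
    (hb : Function.Bijective (assemble m g)) {ℓ : S} (hℓ : ℓ ∈ nonvanishing J)
    (hL : aeval g ℓ ∈ forms m) : aeval g ℓ ∈ nonvanishing (pullback g J) := by
  refine ⟨⟨m, hL⟩, fun p hp => ?_⟩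
  rw [eval_aeval]
  refine hJ.eval_ne_zero (exists_eval_ne_zero hm hg hb p.rep_nonzero) (fun F hF => ?_) hℓ
  rw [← eval_aeval]
  exact hp _ (Ideal.mem_map_of_mem _ hF)

lemma finiteDimensional_wforms (hm : 0 < m) (c : ℤ) : FiniteDimensional ℂ (wforms m c) := by
  by_cases h : (m : ℤ) ∣ c
  · obtain ⟨q, rfl⟩ := h
    rw [wforms_mul (by lia)]
    infer_instance
  · rw [wforms_of_not_dvd h]
    infer_instance

/-- The graded pieces of the pullback of an ideal, decomposed. -/
lemma idealDim_pullback (hm : 0 < m) (hg : ∀ i, (g i).IsHomogeneous m)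
    (hb : Function.Bijective (assemble m g)) (I : Ideal S) (d : ℤ) :
    idealDim (pullback g I) d = ∑ e : Fin 3 → Fin m, Module.finrank ℂ
      (I.restrictScalars ℂ ⊓ wforms m (d - (smallExp e).degree) : Submodule ℂ S) := by
  have := fun c => finiteDimensional_wforms hm c
  let W : (Fin 3 → Fin m) → Submodule ℂ S := fun e =>
    I.restrictScalars ℂ ⊓ wforms m (d - (smallExp e).degree)
  let incl : (∀ e, W e) →ₗ[ℂ] ((Fin 3 → Fin m) → S) :=
    LinearMap.pi fun e => (W e).subtype ∘ₗ LinearMap.proj e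
  have hincl : Function.Injective incl :=
    fun _ _ h => funext fun e => Subtype.ext (congrFun h e)
  have hrange : (assemble m g ∘ₗ incl).range = (pullback g I).restrictScalars ℂ ⊓ forms d := by
    ext F
    constructor
    · rintro ⟨x, rfl⟩
      refine ⟨(assemble_mem_pullback_iff hb I _).2 fun e => (x e).2.1, ?_⟩
      rw [LinearMap.comp_apply, assemble_apply]
      refine sum_mem fun e _ => ?_
      have := mul_mem_forms (aeval_mem_forms hg (x e).2.2) (monomial_mem_forms (smallExp e) 1)
      rwa [sub_add_cancel] at this
    · rintro ⟨hF, hFd⟩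
      obtain ⟨A, rfl⟩ := hb.2 F
      have hA := (assemble_mem_pullback_iff hb I A).1 hF
      have h1 := comp_of_mem hFd
      rw [comp_assemble hm hg] at h1
      have h2 := hb.1 h1
      refine ⟨fun e => ⟨A e, hA e, ?_⟩, rfl⟩
      rw [← congrFun h2 e]
      exact comp_mem _ _ _
  have hfin : Module.finrank ℂ (∀ e, W e) = ∑ e, Module.finrank ℂ (W e) :=
    Module.finrank_pi_fintype ℂ
  have hinj : Function.Injective (assemble m g ∘ₗ incl) := hb.1.comp hincl
  rw [idealDim, ← hrange, LinearMap.finrank_range_of_inj hinj, hfin]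

lemma idealDim_top (d : ℤ) : idealDim ⊤ d = Module.finrank ℂ (forms d) := by
  rw [idealDim, Submodule.restrictScalars_top, top_inf_eq]

lemma pullback_top : pullback g ⊤ = ⊤ := Ideal.map_top _

lemma hilb_pullback (hm : 0 < m) (hg : ∀ i, (g i).IsHomogeneous m)
    (hb : Function.Bijective (assemble m g)) (J : Ideal S) (d : ℤ) :
    hilb (pullback g J) d = ∑ e : Fin 3 → Fin m,
      if (m : ℤ) ∣ d - (smallExp e).degree then hilb J ((d - (smallExp e).degree) / m) else 0 := by
  -- The unit ideal pulls back to itself, so dim S_d has the same decomposition and the two sums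
  -- subtract termwise.
  rw [hilb, ← idealDim_top, ← pullback_top (g := g), idealDim_pullback hm hg hb,
    idealDim_pullback hm hg hb, Nat.cast_sum, Nat.cast_sum, ← Finset.sum_sub_distrib]
  refine Finset.sum_congr rfl fun e _ => ?_
  have hm' : (m : ℤ) ≠ 0 := by lia
  split_ifs with h
  · obtain ⟨q, hq⟩ := h
    rw [hq, wforms_mul hm', Int.mul_ediv_cancel_left _ hm', hilb, ← idealDim_top]
    rfl
  · rw [wforms_of_not_dvd h, inf_bot_eq, inf_bot_eq, sub_self]

/-- The defect of the pullback, in terms of the Hilbert function of the scheme of degree `c`. -/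
lemma defect_pullback (hJ : IsIdealOfZeroDimScheme J) (hm : 0 < m)
    (hg : ∀ i, (g i).IsHomogeneous m) (hb : Function.Bijective (assemble m g)) {c N : ℤ}
    (hc : ∀ d, N ≤ d → hilb J d = c) (d : ℤ) :
    (defect (pullback g J) d : ℤ) = ∑ e : Fin 3 → Fin m,
      if (m : ℤ) ∣ d - (smallExp e).degree
        then c - hilb J ((d - (smallExp e).degree) / m) else 0 := by
  obtain ⟨ℓ, hℓ, hne⟩ := hJ.exists_linear_nonvanishing
  have hm' : (m : ℤ) ≠ 0 := by lia
  have hL : aeval g ℓ ∈ forms m := by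
    refine aeval_mem_forms hg ?_
    have h := wforms_mul hm' 1
    rw [mul_one] at h
    rwa [h]
  obtain ⟨N₀, hN₀⟩ := (hJ.isHomog.pullback hm hg hb).exists_defect_eq hm hL
    (aeval_mem_nonvanishing hJ.isHomog hm hg hb hne hL)
    (fun F => mem_of_aeval_mul_mem_pullback hb fun F => hJ.mem_of_mul_mem hne) d
  -- The power of L is so large that every argument of `hilb J` in the first sum lies beyond N,
  -- where the value is c.
  rw [hN₀ (N₀ + N.natAbs + d.natAbs + 3 * m) (by lia), hilb_pullback hm hg hb,
    hilb_pullback hm hg hb, ← Finset.sum_sub_distrib]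
  refine Finset.sum_congr rfl fun e _ => ?_
  simp only [add_sub_assoc, Int.dvd_add_right (Dvd.intro_left _ rfl)]
  split_ifs with h
  · obtain ⟨q, hq⟩ := h
    have he := degree_smallExp_add_three_le e
    rw [hq, mul_comm _ (m : ℤ), ← mul_add, Int.mul_ediv_cancel_left _ hm',
      Int.mul_ediv_cancel_left _ hm', hc]
    have hq' : -(d.natAbs + 3 * m : ℤ) ≤ q := by
      rcases le_or_gt 0 q with h0 | h0
      · lia
      · have : (m : ℤ) * q ≤ q := by nlinarith
        lia
    lia
  · rw [sub_zero]

end Pullback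

/-! ### General triples of forms -/

/-- Two properties of a general triple hold simultaneously for some triple. -/
lemma ForGeneral.exists_and {m : ℕ} {Q Q' : (Fin 3 → S) → Prop} (h : ForGeneral m Q)
    (h' : ForGeneral m Q') : ∃ g : Fin 3 → S, (∀ i, (g i).IsHomogeneous m) ∧ Q g ∧ Q' g := by
  obtain ⟨P, ⟨g₁, hg₁, hP⟩, hQ⟩ := h
  obtain ⟨P', ⟨g₂, hg₂, hP'⟩, hQ'⟩ := h'
  -- `ρ` kills the variables at exponents of degree other than m, which forms of degree m do not
  -- have. Each image is a nonzero polynomial, so their product is nonzero at some point, which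
  -- yields the triple.
  let ρ : MvPolynomial (Fin 3 × (Fin 3 →₀ ℕ)) ℂ →ₐ[ℂ] MvPolynomial (Fin 3 × (Fin 3 →₀ ℕ)) ℂ :=
    aeval fun q => if q.2.degree = m then X q else 0
  have hρ : ∀ c A, eval c (ρ A) = eval (fun q => if q.2.degree = m then c q else 0) A := by
    intro c A
    have : (aeval c).comp ρ = aeval fun q : Fin 3 × (Fin 3 →₀ ℕ) =>
        if q.2.degree = m then c q else 0 := by
      ext q
      simp only [ρ, AlgHom.comp_apply, aeval_X]
      split_ifs <;> simp
    exact DFunLike.congr_fun this A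
  have hcoeff : ∀ g : Fin 3 → S, (∀ i, (g i).IsHomogeneous m) →
      (fun q : Fin 3 × (Fin 3 →₀ ℕ) => if q.2.degree = m then coeff q.2 (g q.1) else 0)
        = fun q => coeff q.2 (g q.1) := by
    intro g hg
    ext q
    split_ifs with hq
    · rfl
    · by_contra hne
      have := mem_forms.1 (mem_forms_natCast.2 (hg q.1)) q.2 (Ne.symm hne)
      exact hq (by exact_mod_cast this)
  have hne : ρ P * ρ P' ≠ 0 := by
    refine mul_ne_zero (fun h0 => hP ?_) (fun h0 => hP' ?_)
    · rw [← hcoeff g₁ hg₁, ← hρ, h0, map_zero]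
    · rw [← hcoeff g₂ hg₂, ← hρ, h0, map_zero]
  obtain ⟨c, hc⟩ : ∃ c, eval c (ρ P * ρ P') ≠ 0 := by
    by_contra! hall
    exact hne (MvPolynomial.funext fun c => by rw [hall c, map_zero])
  rw [map_mul, hρ, hρ] at hc
  let g : Fin 3 → S := fun i =>
    ∑ γ ∈ (Finset.univ : Finset (Fin 3)).finsuppAntidiag m, monomial γ (c (i, γ))
  have hg : ∀ i, (g i).IsHomogeneous m := by
    refine fun i => IsHomogeneous.sum _ _ _ fun γ hγ => isHomogeneous_monomial _ ?_
    rw [Finsupp.degree_eq_sum, (Finset.mem_finsuppAntidiag.1 hγ).1]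
  have hgc : (fun q : Fin 3 × (Fin 3 →₀ ℕ) => if q.2.degree = m then c q else 0)
      = fun q => coeff q.2 (g q.1) := by
    ext q
    simp only [g, coeff_sum, coeff_monomial, Finset.sum_ite_eq', Finset.mem_finsuppAntidiag,
      Finset.subset_univ, and_true, Finsupp.degree_eq_sum, Prod.mk.eta]
  rw [hgc] at hc
  exact ⟨g, hg, hQ g hg (left_ne_zero_of_mul hc), hQ' g hg (right_ne_zero_of_mul hc)⟩

lemma ForGeneral.mono {m : ℕ} {Q Q' : (Fin 3 → S) → Prop} (h : ForGeneral m Q)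
    (hQ : ∀ g : Fin 3 → S, (∀ i, (g i).IsHomogeneous m) → Q g → Q' g) : ForGeneral m Q' := by
  obtain ⟨P, hP, hPQ⟩ := h
  exact ⟨P, hP, fun g hg hne => hQ g hg (hPQ g hg hne)⟩

/-! ### The defect in degree `mn - 3` -/

section MainDegree

variable {J : Ideal S} {g : Fin 3 → S} {c N : ℤ}

/-- The exponents `e` of degree `4k - 3` contribute the defect of `Z(J)` in degree `n - 2`. -/
lemma sq_mul_le_defect (hJ : IsIdealOfZeroDimScheme J) {k : ℕ} (hk : 0 < k)
    (hg : ∀ i, (g i).IsHomogeneous (2 * k)) (hb : Function.Bijective (assemble (2 * k) g))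
    (hle : ∀ d, hilb J d ≤ c) (hc : ∀ d, N ≤ d → hilb J d = c) (n : ℤ) :
    (k : ℤ) * k * (c - hilb J (n - 2))
      ≤ defect (pullback g J) ((2 * k : ℕ) * n - 3) := by
  rw [defect_pullback hJ (by lia) hg hb hc]
  -- With m = 2k these are k² distinct exponents with |e| = 2m - 3, all entries below m. Even m
  -- suffice to defeat a linear bound.
  let ι : Fin k × Fin k → (Fin 3 → Fin (2 * k)) := fun p =>
    ![⟨2 * k - 2 - p.1, by lia⟩, ⟨2 * k - 2 - p.2, by lia⟩, ⟨p.1 + p.2 + 1, by lia⟩]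
  have hι : Function.Injective ι := by
    rintro ⟨x, y⟩ ⟨x', y'⟩ h
    have h0 : 2 * k - 2 - (x : ℕ) = 2 * k - 2 - x' := congrArg Fin.val (congrFun h 0)
    have h1 : 2 * k - 2 - (y : ℕ) = 2 * k - 2 - y' := congrArg Fin.val (congrFun h 1)
    ext <;> simp only <;> lia
  have hdeg : ∀ p, (smallExp (ι p)).degree + 3 = 2 * (2 * k) := by
    rintro ⟨x, y⟩
    rw [degree_fin_three]
    change (2 * k - 2 - (x : ℕ)) + (2 * k - 2 - (y : ℕ)) + (x + y + 1) + 3 = _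
    lia
  have hterm : ∀ p, (if ((2 * k : ℕ) : ℤ) ∣ (2 * k : ℕ) * n - 3 - (smallExp (ι p)).degree
      then c - hilb J (((2 * k : ℕ) * n - 3 - (smallExp (ι p)).degree) / (2 * k : ℕ)) else 0)
      = c - hilb J (n - 2) := by
    intro p
    have h1 : ((2 * k : ℕ) : ℤ) * n - 3 - (smallExp (ι p)).degree = (2 * k : ℕ) * (n - 2) := by
      have := hdeg p
      zify at this
      push_cast
      linarith
    rw [h1, if_pos (Dvd.intro _ rfl), Int.mul_ediv_cancel_left _ (by lia)]
  calc (k : ℤ) * k * (c - hilb J (n - 2)) = ∑ p : Fin k × Fin k, (c - hilb J (n - 2)) := by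
        simp [mul_sub]
    _ = ∑ e ∈ Finset.univ.map ⟨ι, hι⟩, _ := by
        rw [Finset.sum_map]
        exact Finset.sum_congr rfl fun p _ => (hterm p).symm
    _ ≤ _ := Finset.sum_le_univ_sum_of_nonneg fun e => by
        split_ifs
        · exact sub_nonneg.2 (hle _)
        · exact le_rfl

/-- If `Z(J)` has no defect in degrees at least `n - 2`, the defect of the pullback in degree
`mn - 3` is the defect of `Z(J)` in degree `n - 3`. -/
lemma defect_pullback_eq (hJ : IsIdealOfZeroDimScheme J) {m : ℕ} (hm : 0 < m)
    (hg : ∀ i, (g i).IsHomogeneous m) (hb : Function.Bijective (assemble m g)) {n : ℤ}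
    (hc : ∀ d, n - 2 ≤ d → hilb J d = c) :
    (defect (pullback g J) (m * n - 3) : ℤ) = c - hilb J (n - 3) := by
  have hm' : (m : ℤ) ≠ 0 := by lia
  -- Only this exponent has |e| = 3m - 3. For any other, the argument q of `hilb J` satisfies m(n -
  -- q) < 3m, hence q ≥ n - 2.
  rw [defect_pullback hJ hm hg hb hc, Finset.sum_eq_single fun _ => ⟨m - 1, by lia⟩]
  · have h1 : (m : ℤ) * n - 3 - (smallExp fun _ : Fin 3 => (⟨m - 1, by lia⟩ : Fin m)).degree
        = m * (n - 3) := by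
      rw [degree_fin_three]
      simp only [smallExp_apply]
      rw [mul_sub]
      lia
    rw [h1, if_pos (Dvd.intro _ rfl), Int.mul_ediv_cancel_left _ hm']
  · intro e _ he
    split_ifs with h
    · obtain ⟨q, hq⟩ := h
      rw [hq, Int.mul_ediv_cancel_left _ hm', hc, sub_self]
      have hlt : (smallExp e).degree + 3 < 3 * m := by
        refine lt_of_le_of_ne (degree_smallExp_add_three_le e) fun heq => he ?_
        rw [degree_fin_three] at heq
        simp only [smallExp_apply] at heq
        have h0 := (e 0).2
        have h1 := (e 1).2
        have h2 := (e 2).2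
        funext i
        ext
        fin_cases i <;> simp <;> lia
      zify at hlt
      have h3 : (m : ℤ) * (n - q) < m * 3 := by
        rw [mul_sub]
        lia
      have := lt_of_mul_lt_mul_left h3 (by lia)
      lia
    · rfl
  · simp

end MainDegree

/-! ### Consequences of the linear bound, and the theorem -/

/-- A quadratic function with a linear upper bound vanishes. -/
lemma eq_zero_of_sq_mul_le {D : ℤ} (hD : 0 ≤ D) {α β : ℝ}
    (h : ∀ k : ℕ, 0 < k → (k : ℝ) * k * D ≤ α * (2 * k : ℕ) + β) : D = 0 := by
  by_contra hne
  have hD1 : (1 : ℝ) ≤ D := by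
    have : 1 ≤ D := by lia
    exact_mod_cast this
  -- The factor 2 comes from m = 2k; since k ≥ 1, the constant |β| is at most |β| k.
  obtain ⟨k, hk⟩ := exists_nat_gt (2 * |α| + |β| + 1)
  have hα := abs_nonneg α
  have hβ := abs_nonneg β
  have hk1 : (1 : ℝ) ≤ k := by linarith
  have hkpos : 0 < k := by
    have : (0 : ℝ) < k := by linarith
    exact_mod_cast this
  have h1 := h k hkpos
  push_cast at h1
  have h2 : (k : ℝ) * k ≤ k * k * D := le_mul_of_one_le_right (by positivity) hD1
  have h3 : α * k ≤ |α| * k := mul_le_mul_of_nonneg_right (le_abs_self α) (by linarith)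
  have h4 : β ≤ |β| * k := (le_abs_self β).trans (le_mul_of_one_le_right hβ hk1)
  have h5 : (2 * |α| + |β| + 1) * k < k * k := mul_lt_mul_of_pos_right hk (by linarith)
  linarith

/-- A linear bound on the defects forces `Z(J)` to have no defect in degrees at least `n - 2`. -/
lemma hilb_eq_of_defect_bound {J : Ideal S} (hJ : IsIdealOfZeroDimScheme J) {c N n : ℤ}
    (hle : ∀ d, hilb J d ≤ c) (hc : ∀ d, N ≤ d → hilb J d = c) {α β : ℝ}
    (hbound : ∀ m : ℕ, 0 < m → ForGeneral m fun g =>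
      (defect (pullback g J) (m * n - 3) : ℝ) ≤ α * m + β) {d : ℤ} (hd : n - 2 ≤ d) :
    hilb J d = c := by
  have h0 : c - hilb J (n - 2) = 0 := by
    refine eq_zero_of_sq_mul_le (sub_nonneg.2 (hle _)) (α := α) (β := β) fun k hk => ?_
    obtain ⟨g, hg, hδ, hb⟩ :=
      (hbound (2 * k) (by lia)).exists_and (forGeneral_assemble_bijective (by lia))
    have h1 := sq_mul_le_defect hJ hk hg hb hle hc n
    have h2 : ((k : ℝ) * k * (c - hilb J (n - 2) : ℤ))
        ≤ defect (pullback g J) ((2 * k : ℕ) * n - 3) := by exact_mod_cast h1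
    exact h2.trans hδ
  have h1 := hJ.hilb_mono hd
  have h2 := hle d
  lia

/-- The degrees in a minimal resolution of a scheme without defect in degrees at least `n - 2`. -/
lemma IsMinimalResolution.degree_bounds {J : Ideal S} {t : ℕ} {a : Fin (t + 1) → ℤ}
    {b : Fin t → ℤ} {f : Fin (t + 1) → S} {M : Matrix (Fin (t + 1)) (Fin t) S}
    (hres : IsMinimalResolution J a b f M) {c n : ℤ} (hn : 2 ≤ n) (hle : ∀ d, hilb J d ≤ c)
    (hc : ∀ d, n - 2 ≤ d → hilb J d = c) :
    (∀ j, b j ≤ n) ∧ (∀ i, a i < n) ∧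
      c - hilb J (n - 3) = (Finset.univ.filter fun j => b j = n).card := by
  -- Here k - 3 ≥ n - 2, so all four values of h are c; and k ≠ 0 because n ≥ 2.
  have hcard : ∀ k, n < k → (Finset.univ.filter fun i => a i = k).card
      = (Finset.univ.filter fun j => b j = k).card := by
    intro k hk
    have h := hres.third_diff_hilb k
    rw [hc k (by lia), hc (k - 1) (by lia), hc (k - 2) (by lia), hc (k - 3) (by lia),
      if_neg (by lia)] at h
    lia
  have hcard_n : c - hilb J (n - 3) + (Finset.univ.filter fun i => a i = n).card
      = (Finset.univ.filter fun j => b j = n).card := by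
    have h := hres.third_diff_hilb n
    rw [hc n (by lia), hc (n - 1) (by lia), hc (n - 2) (by lia), if_neg (by lia)] at h
    lia
  -- A largest b_j above n would be matched by an equal a_i, which in turn lies below some b_j.
  have hbn : ∀ j, b j ≤ n := by
    by_contra! ⟨j₀, hj₀⟩
    have : Nonempty (Fin t) := ⟨j₀⟩
    obtain ⟨j, hj⟩ := Finite.exists_max b
    have hpos : 0 < (Finset.univ.filter fun i => a i = b j).card := by
      rw [hcard (b j) (hj₀.trans_le (hj j₀)), Finset.card_pos]
      exact ⟨j, by simp⟩
    obtain ⟨i, hi⟩ := Finset.card_pos.1 hpos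
    obtain ⟨j', hj'⟩ := hres.exists_lt (Fin.pos j₀) i
    rw [(Finset.mem_filter.1 hi).2] at hj'
    exact absurd (hj j') (not_le.2 hj')
  have han : ∀ i, a i < n := by
    intro i
    -- Without syzygies `exists_lt` does not apply, but then all counts of the b_j are zero and the
    -- two counting identities suffice.
    rcases Nat.eq_zero_or_pos t with rfl | ht
    · by_contra! hi
      have hpos : 0 < (Finset.univ.filter fun i' => a i' = a i).card :=
        Finset.card_pos.2 ⟨i, Finset.mem_filter.2 ⟨Finset.mem_univ i, rfl⟩⟩
      rcases hi.lt_or_eq with h | h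
      · have := hcard _ h
        simp only [Finset.univ_eq_empty, Finset.filter_empty, Finset.card_empty] at this
        lia
      · have h3 := hle (n - 3)
        rw [← h] at hpos
        simp only [Finset.univ_eq_empty, Finset.filter_empty, Finset.card_empty] at hcard_n
        lia
    · obtain ⟨j, hj⟩ := hres.exists_lt ht i
      exact hj.trans_le (hbn j)
  refine ⟨hbn, han, ?_⟩
  rw [← hcard_n, Finset.filter_eq_empty_iff.2 fun i _ => (han i).ne]
  simp

end PlaneScheme

end

theorem mainTheorem9 (J : Ideal PlaneScheme.S) (hJ : PlaneScheme.IsIdealOfZeroDimScheme J)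
    {t : ℕ} (a : Fin (t + 1) → ℤ) (b : Fin t → ℤ)
    (f : Fin (t + 1) → PlaneScheme.S) (M : Matrix (Fin (t + 1)) (Fin t) PlaneScheme.S)
    (hres : PlaneScheme.IsMinimalResolution J a b f M)
    (n : ℤ) (α β : ℝ)
    (hbound : ∀ m : ℕ, 0 < m → PlaneScheme.ForGeneral m fun g =>
      (PlaneScheme.defect (PlaneScheme.pullback g J) (m * n - 3) : ℝ) ≤ α * m + β) :
    (∀ j, b j ≤ n) ∧ (∀ i, a i < n) ∧
      ∀ m : ℕ, 0 < m → PlaneScheme.ForGeneral m fun g =>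
        PlaneScheme.defect (PlaneScheme.pullback g J) (m * n - 3) =
          (Finset.univ.filter fun j => b j = n).card := by
  obtain ⟨c, hc0, hle, N, hN⟩ := hJ.exists_degree
  have hc : ∀ d, n - 2 ≤ d → PlaneScheme.hilb J d = c := fun d hd =>
    PlaneScheme.hilb_eq_of_defect_bound hJ hle hN hbound hd
  -- Otherwise h(n - 2) = 0, while c > 0 as Z(J) is nonempty.
  have hn : 2 ≤ n := by
    by_contra! hn
    have h := hc (n - 2) le_rfl
    rw [PlaneScheme.hilb_of_neg J (by lia)] at h
    lia
  obtain ⟨hbn, han, hcard⟩ := hres.degree_bounds hn hle hc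
  refine ⟨hbn, han, fun m hm => ?_⟩
  refine (PlaneScheme.forGeneral_assemble_bijective hm).mono fun g hg hb => ?_
  have := PlaneScheme.defect_pullback_eq hJ hm hg hb hc
  rw [hcard] at this
  exact_mod_cast this
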